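/- **Setting.** Points lie in $\mathbb{R}_{\ge 0}^d$. A scoring function $f:\mathbb{R}_{\ge 0}^d\to\mathbb{R}_{\ge 0}$ is monotone if $f(x)\le f(y)$ whenever $x[i]\le y[i]$ for all $i$. For a set $\mathcal F$ of monotone scoring functions, a point $x$ $\mathcal F$-dominates a point $y\ne x$ if $f(x)\le f(y)$ for all $f\in\mathcal F$; the restricted skyline $\mathrm{RSKY}(D,\mathcal F)$ of a dataset $D$ is the set of points of $D$ that are $\mathcal F$-dominated by no point of $D$. An uncertain dataset $\mathcal D$ consists of pairwise disjoint nonempty finite sets $T_1,\dots,T_m$ of points (the uncertain objects) and probabilities $p(t)\ge 0$ of their elements (the instances) with $\sum_{t\in T_i}p(t)\le 1$ for each $i$; $I=\bigcup_i T_i$ and $n=|I|$. A possible world is a set $D\subseteq I$ with $|D\cap T_i|\le 1$ for all $i$; it has probability $$\Pr(D)=\prod_{t\in D}p(t)\cdot\prod_{i:\,T_i\cap D=\emptyset}\Bigl(1-\sum_{t\in T_i}p(t)\Bigr).$$ The rskyline probability of $t\in I$ is $\mathrm{Pr}_{\mathrm{rsky}}(t)=\sum_{D\,:\,t\in \mathrm{RSKY}(D,\mathcal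 F)}\Pr(D)$, the sum being over possible worlds $D$. **Model.** Algorithms are programs of a random access machine with words of $O(\log n)$ bits and with data cells for numbers, which admit addition, subtraction, multiplication, division and comparison but no rounding; each instruction and each test costs one step. Data cells hold either arbitrary real numbers (real RAM), or fractions whose numerator and denominator have $O(\log n)$ bits (word RAM). In either case all words of the input, and in the second case all input numbers and all rskyline probabilities to be computed as well, are assumed to have size polynomial in $n$. The set $\mathcal F$ is part of the input, as a finite list of linear scoring functions, or as a system of linear constraints on the weights $\omega$, in the standard simplex, of the linear scoring functions $t\mapsto\sum_i\omega[i]t[i]$. **Orthogonal Vectors conjecture** (for a fixed choice of the model). For every $\delta>0$ there is an integer $c\ge1$ such that no $O(n^{2-\delta})$-time algorithm decides, for all $n$, all $1\le d\le c\log_2 n$ and all sets $A,B$ of $n$ vectors in $\{0,1\}^d$, whether there are $a\in A$, $b\in B$ with $\sum_i a[i]b[i]=0$. **Theorem.** In each of the two models, assume the Orthogonal Vectors conjecture. Then no algorithm computes, from an uncertain dataset $\mathcal D$ and a set $\mathcal F$ of monotone scoring functions, the rskyline probabilities of all instances in $O(n^{2-\delta})$ time for any $\delta>0$. More precisely, for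 every $\delta>0$ there is an integer $c\ge 1$ such that no algorithm does so in $O(n^{2-\delta})$ time on all inputs with $1\le d\le c\log_2 n$ in which the words (and, in the word RAM, also the input numbers and the numerators and denominators of the rskyline probabilities) are bounded by $n^c$, and this holds 1. even if $\mathcal F$ is always the set of the $d$ coordinate projections $t\mapsto t[i]$, and 2. even if $\mathcal F$ is always the set of all linear scoring functions $t\mapsto\sum_i\omega[i]t[i]$ with $\omega[i]\ge 0$ and $\sum_i\omega[i]=1$. -/

import Mathlib

open scoped NNReal

noncomputable section

/-! ## The machine model

A random access machine with word registers and word memory (natural numbers, used for control,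
addressing and integer arithmetic) and data registers and data memory (real numbers, on which only
field operations and comparisons are available: there is no rounding and no other way from data to
words). On inputs of size `n` every word has `O(log n)` bits. Programs are structured, and every
instruction and every evaluated test costs one step. -/

/-- Two readings of the machine. `exact`: data cells hold arbitrary real numbers (the real RAM,
with `O(log n)`-bit words on the integer side). `bounded`: data cells hold fractions whose
numerator and denominator have `O(log n)` bits, so that a data cell is a pair of words (the word
RAM). -/
inductive Arith
  | exact
  | bounded

structure State where
  wreg : ℕ → ℕ
  wmem : ℕ → ℕ
  dreg : ℕ → ℝ
  dmem : ℕ → ℝ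

inductive WordOp
  | add | sub | mul | div | mod | and | or | xor | shl | shr

def WordOp.eval : WordOp → ℕ → ℕ → ℕ
  | .add, a, b => a + b
  | .sub, a, b => a - b
  | .mul, a, b => a * b
  | .div, a, b => a / b
  | .mod, a, b => a % b
  | .and, a, b => a &&& b
  | .or,  a, b => a ||| b
  | .xor, a, b => a ^^^ b
  | .shl, a, b => a <<< b
  | .shr, a, b => a >>> b

inductive DataOp
  | add | sub | mul | div

def DataOp.eval : DataOp → ℝ → ℝ → ℝ
  | .add, x, y => x + y
  | .sub, x, y => x - y
  | .mul, x, y => x * y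
  | .div, x, y => x / y

/-- Instructions. All arguments are numbers of registers, except the literal `k` of `wconst`. -/
inductive Instr
  /-- word register `i` := `k` -/
  | wconst (i k : ℕ)
  /-- word register `i` := word register `j` `op` word register `k` -/
  | wop (op : WordOp) (i j k : ℕ)
  /-- word register `i` := word memory at the address in word register `j` -/
  | wload (i j : ℕ)
  /-- word memory at the address in word register `i` := word register `j` -/
  | wstore (i j : ℕ)
  /-- data register `i` := word register `j` -/
  | dcast (i j : ℕ)
  /-- data register `i` := data register `j` `op` data register `k` -/
  | dop (op : DataOp) (i j k : ℕ)
  /-- data register `i` := data memory at the address in word register `j` -/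
  | dload (i j : ℕ)
  /-- data memory at the address in word register `i` := data register `j` -/
  | dstore (i j : ℕ)

def Instr.apply : Instr → State → State
  | .wconst i k, s => { s with wreg := Function.update s.wreg i k }
  | .wop op i j k, s =>
      { s with wreg := Function.update s.wreg i (op.eval (s.wreg j) (s.wreg k)) }
  | .wload i j, s => { s with wreg := Function.update s.wreg i (s.wmem (s.wreg j)) }
  | .wstore i j, s => { s with wmem := Function.update s.wmem (s.wreg i) (s.wreg j) }
  | .dcast i j, s => { s with dreg := Function.update s.dreg i (s.wreg j : ℝ) }
  | .dop op i j k, s =>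
      { s with dreg := Function.update s.dreg i (op.eval (s.dreg j) (s.dreg k)) }
  | .dload i j, s => { s with dreg := Function.update s.dreg i (s.dmem (s.wreg j)) }
  | .dstore i j, s => { s with dmem := Function.update s.dmem (s.wreg i) (s.dreg j) }

/-- Comparisons of two word registers or of two data registers. -/
inductive Test
  | wlt (i j : ℕ)
  | weq (i j : ℕ)
  | dlt (i j : ℕ)
  | deq (i j : ℕ)

def Test.holds : Test → State → Prop
  | .wlt i j, s => s.wreg i < s.wreg j
  | .weq i j, s => s.wreg i = s.wreg j
  | .dlt i j, s => s.dreg i < s.dreg j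
  | .deq i j, s => s.dreg i = s.dreg j

inductive Prog
  | skip
  | instr (I : Instr)
  | seq (p q : Prog)
  | ite (b : Test) (p q : Prog)
  | loop (b : Test) (p : Prog)

/-- `x` is a fraction whose numerator and denominator are at most `B` in absolute value. -/
def HeightLE (B : ℕ) (x : ℝ) : Prop :=
  ∃ q : ℚ, (q : ℝ) = x ∧ q.num.natAbs ≤ B ∧ q.den ≤ B

/-- The number `x` fits into a data cell. -/
def FitsData : Arith → ℕ → ℝ → Prop
  | .exact, _, _ => True
  | .bounded, B, x => HeightLE B x

/-- All cells hold admissible values; `B` is the bound on the words. -/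
def State.Fits (μ : Arith) (B : ℕ) (s : State) : Prop :=
  (∀ i, s.wreg i ≤ B) ∧ (∀ i, s.wmem i ≤ B) ∧
    (∀ i, FitsData μ B (s.dreg i)) ∧ (∀ i, FitsData μ B (s.dmem i))

/-- `Exec μ B p s t s'`: started in the state `s`, the program `p` halts in the state `s'` after
exactly `t` steps, and no instruction produces an inadmissible value on the way. -/
inductive Exec (μ : Arith) (B : ℕ) : Prog → State → ℕ → State → Prop
  | skip (s : State) : Exec μ B .skip s 0 s
  | instr (I : Instr) (s : State) (h : (I.apply s).Fits μ B) :
      Exec μ B (.instr I) s 1 (I.apply s)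
  | seq {p q : Prog} {s₁ s₂ s₃ : State} {t₁ t₂ : ℕ} (h₁ : Exec μ B p s₁ t₁ s₂)
      (h₂ : Exec μ B q s₂ t₂ s₃) : Exec μ B (.seq p q) s₁ (t₁ + t₂) s₃
  | ite_true {b : Test} {p q : Prog} {s s' : State} {t : ℕ} (hb : b.holds s)
      (h : Exec μ B p s t s') : Exec μ B (.ite b p q) s (t + 1) s'
  | ite_false {b : Test} {p q : Prog} {s s' : State} {t : ℕ} (hb : ¬ b.holds s)
      (h : Exec μ B q s t s') : Exec μ B (.ite b p q) s (t + 1) s'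
  | loop_true {b : Test} {p : Prog} {s₁ s₂ s₃ : State} {t₁ t₂ : ℕ} (hb : b.holds s₁)
      (h₁ : Exec μ B p s₁ t₁ s₂) (h₂ : Exec μ B (.loop b p) s₂ t₂ s₃) :
      Exec μ B (.loop b p) s₁ (t₁ + t₂ + 1) s₃
  | loop_false {b : Test} {p : Prog} {s : State} (hb : ¬ b.holds s) :
      Exec μ B (.loop b p) s 1 s

/-- The state in which the two memories start with the given lists and all else is zero. -/
def State.init (ws : List ℕ) (ds : List ℝ) : State where
  wreg := fun _ => 0
  wmem := fun i => ws.getD i 0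
  dreg := fun _ => 0
  dmem := fun i => ds.getD i 0

/-- The entries of a table, row by row. -/
def rowMajor {α : Type*} {k l : ℕ} (M : Fin k → Fin l → α) : List α :=
  List.ofFn fun x : Fin (k * l) => M x.divNat x.modNat

/-! ## Orthogonal vectors -/

/-- Word memory: `n`, `d`, the vectors of `A`, the vectors of `B`. -/
def ovInput {n d : ℕ} (A B : Fin n → Fin d → Bool) : State :=
  State.init ([n, d] ++ rowMajor (fun a i => (A a i).toNat) ++
    rowMajor (fun b i => (B b i).toNat)) []

def HasOrthogonalPair {n d : ℕ} (A B : Fin n → Fin d → Bool) : Prop :=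
  ∃ a b, ∑ i, (A a i).toNat * (B b i).toNat = 0

open Classical in
/-- On all pairs of sets `A`, `B` of `n` vectors in `{0,1}^d`, where `1 ≤ d ≤ c log n`, the program
`P` determines in `O(n^(2-δ))` time (answer 0 or 1 in word register 0) whether some `a ∈ A` and
`b ∈ B` are orthogonal. The words of the machine are bounded by `n^K`. -/
def SolvesOV (μ : Arith) (c : ℕ) (δ : ℝ) (P : Prog) : Prop :=
  ∃ (C : ℝ) (K : ℕ), ∀ (n d : ℕ), 1 ≤ d → (d : ℝ) ≤ c * Real.logb 2 n →
    ∀ A B : Fin n → Fin d → Bool, Function.Injective A → Function.Injective B →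
      ∃ (t : ℕ) (s : State), Exec μ (n ^ K) P (ovInput A B) t s ∧
        (t : ℝ) ≤ C * (n : ℝ) ^ (2 - δ) ∧
        s.wreg 0 = if HasOrthogonalPair A B then 1 else 0

/-- The Orthogonal Vectors conjecture. -/
def OVConjecture (μ : Arith) : Prop :=
  ∀ δ : ℝ, 0 < δ → ∃ c : ℕ, 1 ≤ c ∧ ¬ ∃ P : Prog, SolvesOV μ c δ P

/-! ## Restricted skyline probabilities -/

/-- Points have nonnegative attributes, so that the scores below are nonnegative. -/
abbrev Point (d : ℕ) := Fin d → ℝ≥0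

/-- Monotone scoring functions. -/
abbrev ScoringFn (d : ℕ) := Point d →o ℝ≥0

/-- `x` `F`-dominates `y` (lower scores are preferred). -/
def FDominates {d : ℕ} (F : Set (ScoringFn d)) (x y : Point d) : Prop :=
  x ≠ y ∧ ∀ f ∈ F, f x ≤ f y

/-- The restricted skyline of a dataset `D`. -/
def rsky {d : ℕ} (D : Set (Point d)) (F : Set (ScoringFn d)) : Set (Point d) :=
  {x ∈ D | ¬ ∃ y ∈ D, FDominates F y x}

/-- An uncertain dataset with `m` uncertain objects and `n` instances in dimension `d`. The
instance `t` belongs to the object `obj t`, which occurs as `t` with probability `prob t`. -/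
structure UncertainDataset (n m d : ℕ) where
  point : Fin n → Point d
  point_injective : Function.Injective point
  obj : Fin n → Fin m
  obj_surjective : Function.Surjective obj
  prob : Fin n → ℝ
  prob_nonneg : ∀ t, 0 ≤ prob t
  sum_prob_le_one : ∀ i, ∑ t with obj t = i, prob t ≤ 1

namespace UncertainDataset

variable {n m d : ℕ} (𝒟 : UncertainDataset n m d)

open Classical in
/-- The possible worlds: every object occurs as at most one of its instances. -/
def worlds : Finset (Finset (Fin n)) :=
  {D | Set.InjOn 𝒟.obj (D : Set (Fin n))}

open Classical in
/-- The probability of a possible world. -/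
def worldProb (D : Finset (Fin n)) : ℝ :=
  (∏ t ∈ D, 𝒟.prob t) *
    ∏ i with ∀ t ∈ D, 𝒟.obj t ≠ i, (1 - ∑ t with 𝒟.obj t = i, 𝒟.prob t)

open Classical in
/-- The restricted skyline probability of the instance `t`. -/
def rskyProb (F : Set (ScoringFn d)) (t : Fin n) : ℝ :=
  ∑ D ∈ 𝒟.worlds,
    𝒟.worldProb D * if 𝒟.point t ∈ rsky (𝒟.point '' (D : Set (Fin n))) F then 1 else 0

end UncertainDataset

/-- The linear scoring function with weights `ω`. -/
def linearScore {d : ℕ} (ω : Fin d → ℝ≥0) : ScoringFn d where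
  toFun t := ∑ i, ω i * t i
  monotone' _ _ h := Finset.sum_le_sum fun i _ => mul_le_mul_of_nonneg_left (h i) zero_le

/-- Finite descriptions of sets of scoring functions: a list of `k` linear scoring functions, or
`r` linear constraints `A ω ≤ b` on the weights, in the standard simplex, of the linear scoring
functions. -/
inductive FDesc (d : ℕ)
  | finite (k : ℕ) (w : Fin k → Fin d → ℝ≥0)
  | constraints (r : ℕ) (A : Fin r → Fin d → ℝ) (b : Fin r → ℝ)

namespace FDesc

variable {d : ℕ}

/-- The described set of scoring functions. -/
def toSet : FDesc d → Set (ScoringFn d)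
  | finite _ w => Set.range fun j => linearScore (w j)
  | constraints _ A b =>
      {f | ∃ ω : Fin d → ℝ≥0, ∑ i, ω i = 1 ∧ (∀ j, ∑ i, A j i * (ω i : ℝ) ≤ b j) ∧
        f = linearScore ω}

/-- The kind of the description and the number of weight vectors or constraints. -/
def words : FDesc d → List ℕ
  | finite k _ => [0, k]
  | constraints r _ _ => [1, r]

/-- The weights, or the coefficients of the constraints. -/
def data : FDesc d → List ℝ
  | finite _ w => rowMajor fun j i => (w j i : ℝ)
  | constraints _ A b => rowMajor A ++ List.ofFn b

/-- The `d` coordinate projections `t ↦ t[i]`. -/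
def projections (d : ℕ) : FDesc d := finite d fun j i => if i = j then 1 else 0

/-- All linear scoring functions with weights in the standard simplex. -/
def allLinear (d : ℕ) : FDesc d := constraints 0 Fin.elim0 Fin.elim0

theorem toSet_projections (d : ℕ) :
    (projections d).toSet = {f | ∃ j, ∀ t, f t = t j} := by
  ext f
  simp only [projections, toSet, Set.mem_range, Set.mem_ofPred_eq]
  refine exists_congr fun j => ⟨?_, fun h => ?_⟩
  · rintro rfl t
    simp [linearScore]
  · ext t
    simp [linearScore, h]

theorem toSet_allLinear (d : ℕ) :
    (allLinear d).toSet = {f | ∃ ω : Fin d → ℝ≥0, ∑ i, ω i = 1 ∧ f = linearScore ω} := by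
  simp [allLinear, toSet]

end FDesc

/-- Word memory: `n`, `m`, `d`, the two words of the description of `F`, the object of each
instance. Data memory: the attributes of all instances, their probabilities, the numbers in the
description of `F`. -/
def arspInput {n m d : ℕ} (𝒟 : UncertainDataset n m d) (F : FDesc d) : State :=
  State.init ([n, m, d] ++ F.words ++ List.ofFn fun t => (𝒟.obj t : ℕ))
    (rowMajor (fun t i => (𝒟.point t i : ℝ)) ++ List.ofFn 𝒟.prob ++ F.data)

/-- On all uncertain datasets with `n` instances in dimension `d`, where `1 ≤ d ≤ c log n`,
together with the set `F d` of scoring functions, the program `P` computes the rskyline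
probabilities of all instances in `O(n^(2-δ))` time (and leaves them in the first `n` cells of the
data memory). Only inputs whose numbers have `O(log n)` bits (bound `n^c`) are considered; in the
exact reading this restricts only the words, that is, counts and names of objects. The words of the
machine are bounded by `n^K`. -/
def SolvesARSP (μ : Arith) (c : ℕ) (δ : ℝ) (F : ∀ d, FDesc d) (P : Prog) : Prop :=
  ∃ (C : ℝ) (K : ℕ), ∀ (n m d : ℕ), 1 ≤ d → (d : ℝ) ≤ c * Real.logb 2 n →
    ∀ 𝒟 : UncertainDataset n m d,
      (arspInput 𝒟 (F d)).Fits μ (n ^ c) →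
      (∀ t, FitsData μ (n ^ c) (𝒟.rskyProb (F d).toSet t)) →
      ∃ (τ : ℕ) (s : State), Exec μ (n ^ K) P (arspInput 𝒟 (F d)) τ s ∧
        (τ : ℝ) ≤ C * (n : ℝ) ^ (2 - δ) ∧
        ∀ t : Fin n, s.dmem t = 𝒟.rskyProb (F d).toSet t

end

/-! A fast algorithm for rskyline probabilities would decide Orthogonal Vectors. Map `a` to the
point `2a` and `b` to the point `3 - 2b`. In each coordinate `2a[i] ≤ 3 - 2b[i]` fails only for
`a[i] = b[i] = 1`, so `a` lies coordinatewise below `b` exactly when they are orthogonal. Both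
families of scoring functions contain the projections and consist of monotone functions, so for both
of them dominance is coordinatewise.

Every `a` is an object of its own with probability 1; all `b` together form one object with
probabilities `1/n`. The worlds of nonzero probability are therefore "all of `A` and one `b`". Two
vectors of `B` never meet, so the probability of `b` is 0 if some `a` is orthogonal to `b`, and
nonzero otherwise (`rskyProb_natAdd_eq_zero_iff`).

The rest makes this a program for the machine: write the dataset over the input (`load_triple`), run
the given program `P`, look for a zero (`scan_triple`). `P` is a black box that expects exact memory
contents and zero registers. The reduction therefore keeps its own data in registers beyond those of
`P`, where `Exec.overlay` protects them. Writing takes `O(nd) = O(n log n)` steps, which is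
`O(n^(3/2))`; hence the saving `δ` is capped at `1/2`. -/

open scoped NNReal

noncomputable section

/-! ## Running a program beside untouched registers -/

/-- A strict upper bound on the numbers of the registers of an instruction. -/
def Instr.regBound : Instr → ℕ
  | .wconst i _ => i + 1
  | .wop _ i j k => i + j + k + 1
  | .wload i j => i + j + 1
  | .wstore i j => i + j + 1
  | .dcast i j => i + j + 1
  | .dop _ i j k => i + j + k + 1
  | .dload i j => i + j + 1
  | .dstore i j => i + j + 1

/-- A strict upper bound on the numbers of the registers of a test. -/
def Test.regBound : Test → ℕ
  | .wlt i j => i + j + 1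
  | .weq i j => i + j + 1
  | .dlt i j => i + j + 1
  | .deq i j => i + j + 1

/-- A strict upper bound on the numbers of the registers of a program. -/
def Prog.regBound : Prog → ℕ
  | .skip => 0
  | .instr I => I.regBound
  | .seq p q => p.regBound + q.regBound
  | .ite b p q => b.regBound + p.regBound + q.regBound
  | .loop b p => b.regBound + p.regBound

/-- The state `s` with the registers from `R` on replaced by those of `g`. -/
def State.overlay (R : ℕ) (s g : State) : State where
  wreg i := if i < R then s.wreg i else g.wreg i
  wmem := s.wmem
  dreg i := if i < R then s.dreg i else g.dreg i
  dmem := s.dmem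

theorem HeightLE.mono {B B' : ℕ} (h : B ≤ B') {x : ℝ} : HeightLE B x → HeightLE B' x :=
  fun ⟨q, hq, h₁, h₂⟩ => ⟨q, hq, h₁.trans h, h₂.trans h⟩

theorem FitsData.mono {μ : Arith} {B B' : ℕ} (h : B ≤ B') {x : ℝ} (hx : FitsData μ B x) :
    FitsData μ B' x := by
  cases μ
  · trivial
  · exact HeightLE.mono h hx

theorem FitsData.of_rat {μ : Arith} {B : ℕ} {x : ℝ} (q : ℚ) (hq : (q : ℝ) = x)
    (h₁ : q.num.natAbs ≤ B) (h₂ : q.den ≤ B) : FitsData μ B x := by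
  cases μ
  · trivial
  · exact ⟨q, hq, h₁, h₂⟩

theorem FitsData.natCast {μ : Arith} {B k : ℕ} (hk : k ≤ B) (hB : 1 ≤ B) :
    FitsData μ B (k : ℝ) :=
  .of_rat k (by simp) (by simpa) (by simpa)

/-- In lowest terms the numerator divides `k` and the denominator divides `l`, so reducing the
fraction cannot enlarge them. For `l = 0` the quotient is 0 by convention. -/
theorem FitsData.natCast_div {μ : Arith} {B k l : ℕ} (hk : k ≤ B) (hl : l ≤ B) (hB : 1 ≤ B) :
    FitsData μ B ((k : ℝ) / l) := by
  rcases Nat.eq_zero_or_pos l with rfl | hl0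
  · simpa using FitsData.natCast (Nat.zero_le B) hB
  refine .of_rat ((k : ℚ) / l) (by simp) ?_ ?_
  · have : ((k : ℚ) / l).num ∣ k := by
      have := Rat.num_dvd (k : ℤ) (show (l : ℤ) ≠ 0 by omega)
      rwa [Rat.divInt_eq_div, Int.cast_natCast, Int.cast_natCast] at this
    rcases Nat.eq_zero_or_pos k with rfl | hk0
    · simp
    · exact (Nat.le_of_dvd hk0 (by simpa using Int.natAbs_dvd_natAbs.2 this)).trans hk
  · have : (((k : ℚ) / l).den : ℤ) ∣ l := by
      have := Rat.den_dvd (k : ℤ) (l : ℤ)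
      rwa [Rat.divInt_eq_div, Int.cast_natCast, Int.cast_natCast] at this
    exact (Nat.le_of_dvd hl0 (by exact_mod_cast this)).trans hl

theorem State.Fits.overlay {μ : Arith} {B B' R : ℕ} (h : B ≤ B') {s g : State}
    (hs : s.Fits μ B) (hg : g.Fits μ B') : (s.overlay R g).Fits μ B' := by
  refine ⟨fun i => ?_, fun i => (hs.2.1 i).trans h, fun i => ?_, fun i => (hs.2.2.2 i).mono h⟩
  · simp only [State.overlay]
    split_ifs
    exacts [(hs.1 i).trans h, hg.1 i]
  · simp only [State.overlay]
    split_ifs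
    exacts [(hs.2.2.1 i).mono h, hg.2.2.1 i]

theorem Instr.apply_overlay {R : ℕ} (I : Instr) (hI : I.regBound ≤ R) (s g : State) :
    I.apply (s.overlay R g) = (I.apply s).overlay R g := by
  have key : ∀ {α : Type} (f f' : ℕ → α) (i : ℕ) (v : α), i < R →
      Function.update (fun x => if x < R then f x else f' x) i v =
        fun x => if x < R then Function.update f i v x else f' x := by
    intro α f f' i v hi
    ext x
    by_cases hx : x = i
    · subst hx; simp [hi]
    · simp [Function.update_of_ne hx]
  cases I <;> simp only [Instr.regBound] at hI <;>
    simp only [Instr.apply, State.overlay, State.mk.injEq, true_and, and_true]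
  case wconst i k => exact key _ _ _ _ (by omega)
  case wop op i j k =>
    rw [if_pos (by omega), if_pos (by omega)]; exact key _ _ _ _ (by omega)
  case wload i j => rw [if_pos (by omega)]; exact key _ _ _ _ (by omega)
  case wstore i j => rw [if_pos (by omega), if_pos (by omega)]
  case dcast i j => rw [if_pos (by omega)]; exact key _ _ _ _ (by omega)
  case dop op i j k =>
    rw [if_pos (by omega), if_pos (by omega)]; exact key _ _ _ _ (by omega)
  case dload i j => rw [if_pos (by omega)]; exact key _ _ _ _ (by omega)
  case dstore i j => rw [if_pos (by omega), if_pos (by omega)]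

theorem Test.holds_overlay {R : ℕ} (b : Test) (hb : b.regBound ≤ R) (s g : State) :
    b.holds (s.overlay R g) ↔ b.holds s := by
  cases b <;> simp only [Test.regBound] at hb <;>
    simp only [Test.holds, State.overlay] <;> rw [if_pos (by omega), if_pos (by omega)]

/-- Registers beyond the bound of a program are neither read nor written: its instructions commute
with the overlay and its tests ignore it. The word bound may grow, since the surrounding program can
need larger words. -/
theorem Exec.overlay {μ : Arith} {B B' R : ℕ} (hBB : B ≤ B') {g : State} (hg : g.Fits μ B')
    {p : Prog} {s s' : State} {t : ℕ} (h : Exec μ B p s t s') (hp : p.regBound ≤ R) :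
    Exec μ B' p (s.overlay R g) t (s'.overlay R g) := by
  induction h with
  | skip s => exact .skip _
  | instr I s h =>
    rw [← I.apply_overlay hp]
    refine .instr I _ ?_
    rw [I.apply_overlay hp]
    exact h.overlay hBB hg
  | seq _ _ ih₁ ih₂ =>
    simp only [Prog.regBound] at hp
    exact .seq (ih₁ (by omega)) (ih₂ (by omega))
  | ite_true hb _ ih =>
    simp only [Prog.regBound] at hp
    exact .ite_true ((Test.holds_overlay _ (by omega) _ _).2 hb) (ih (by omega))
  | ite_false hb _ ih =>
    simp only [Prog.regBound] at hp
    exact .ite_false (by rwa [Test.holds_overlay _ (by omega)]) (ih (by omega))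
  | loop_true hb _ _ ih₁ ih₂ =>
    have hp' := hp
    simp only [Prog.regBound] at hp
    exact .loop_true ((Test.holds_overlay _ (by omega) _ _).2 hb) (ih₁ (by omega)) (ih₂ hp')
  | loop_false hb =>
    simp only [Prog.regBound] at hp
    exact .loop_false (by rwa [Test.holds_overlay _ (by omega)])

theorem Exec.fits {μ : Arith} {B : ℕ} {p : Prog} {s s' : State} {t : ℕ} (h : Exec μ B p s t s')
    (hs : s.Fits μ B) : s'.Fits μ B := by
  induction h with
  | skip s => exact hs
  | instr I s h => exact h
  | seq _ _ ih₁ ih₂ => exact ih₂ (ih₁ hs)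
  | ite_true _ _ ih => exact ih hs
  | ite_false _ _ ih => exact ih hs
  | loop_true _ _ _ ih₁ ih₂ => exact ih₂ (ih₁ hs)
  | loop_false _ => exact hs

/-! ## Triples with running times -/

/-- Started in an admissible state that satisfies `Φ`, the program `p` halts within `T` steps in a
state that satisfies `Ψ`. -/
def Triple (μ : Arith) (B : ℕ) (Φ : State → Prop) (p : Prog) (T : ℕ) (Ψ : State → Prop) : Prop :=
  ∀ s, s.Fits μ B → Φ s → ∃ t s', Exec μ B p s t s' ∧ t ≤ T ∧ Ψ s'

/-- The value written by an instruction is admissible. -/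
def Instr.Ok (μ : Arith) (B : ℕ) : Instr → State → Prop
  | .wconst _ k, _ => k ≤ B
  | .wop op _ j k, s => op.eval (s.wreg j) (s.wreg k) ≤ B
  | .dop op _ j k, s => FitsData μ B (op.eval (s.dreg j) (s.dreg k))
  | _, _ => True

/-- Loads and stores only move admissible values, so only constants and results of operations need a
check. A cast word has denominator 1, whence `1 ≤ B`. -/
theorem Instr.Ok.fits {μ : Arith} {B : ℕ} (hB : 1 ≤ B) {I : Instr} {s : State}
    (h : I.Ok μ B s) (hs : s.Fits μ B) : (I.apply s).Fits μ B := by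
  have key : ∀ {α : Type} (p : α → Prop) (f : ℕ → α) (i : ℕ) (v : α), (∀ x, p (f x)) → p v →
      ∀ x, p (Function.update f i v x) := by
    intro α p f i v hf hv x
    by_cases hx : x = i
    · subst hx; simpa
    · simpa [Function.update_of_ne hx] using hf x
  obtain ⟨h₁, h₂, h₃, h₄⟩ := hs
  cases I
  case wconst => exact ⟨key (· ≤ B) _ _ _ h₁ h, h₂, h₃, h₄⟩
  case wop => exact ⟨key (· ≤ B) _ _ _ h₁ h, h₂, h₃, h₄⟩
  case wload => exact ⟨key (· ≤ B) _ _ _ h₁ (h₂ _), h₂, h₃, h₄⟩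
  case wstore => exact ⟨h₁, key (· ≤ B) _ _ _ h₂ (h₁ _), h₃, h₄⟩
  case dcast => exact ⟨h₁, h₂, key (FitsData μ B) _ _ _ h₃ (.natCast (h₁ _) hB), h₄⟩
  case dop => exact ⟨h₁, h₂, key (FitsData μ B) _ _ _ h₃ h, h₄⟩
  case dload => exact ⟨h₁, h₂, key (FitsData μ B) _ _ _ h₃ (h₄ _), h₄⟩
  case dstore => exact ⟨h₁, h₂, h₃, key (FitsData μ B) _ _ _ h₄ (h₃ _)⟩

/-- A straight-line program. -/
def Prog.block : List Instr → Prog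
  | [] => .skip
  | I :: l => .seq (.instr I) (.block l)

/-- All values written by a straight-line program are admissible and it ends in `Ψ`. -/
def Instr.OkThen (μ : Arith) (B : ℕ) (Ψ : State → Prop) : List Instr → State → Prop
  | [], s => Ψ s
  | I :: l, s => I.Ok μ B s ∧ OkThen μ B Ψ l (I.apply s)

/-- Turns straight-line code into a formula that `simp` can evaluate symbolically. -/
theorem Triple.block {μ : Arith} {B : ℕ} (hB : 1 ≤ B) {Φ Ψ : State → Prop} (l : List Instr)
    (h : ∀ s, s.Fits μ B → Φ s → Instr.OkThen μ B Ψ l s) :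
    Triple μ B Φ (.block l) l.length Ψ := by
  intro s hs hΦ
  have := h s hs hΦ
  clear h hΦ
  induction l generalizing s with
  | nil => exact ⟨0, s, .skip s, le_rfl, this⟩
  | cons I l ih =>
    have hf := this.1.fits hB hs
    obtain ⟨t, s', he, ht, hΨ⟩ := ih _ hf this.2
    exact ⟨1 + t, s', .seq (.instr I s hf) he, by simp; omega, hΨ⟩

theorem Triple.seq {μ : Arith} {B T₁ T₂ : ℕ} {Φ Ψ Χ : State → Prop} {p q : Prog}
    (h₁ : Triple μ B Φ p T₁ Ψ) (h₂ : Triple μ B Ψ q T₂ Χ) :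
    Triple μ B Φ (.seq p q) (T₁ + T₂) Χ := by
  intro s hs hΦ
  obtain ⟨t₁, s₁, e₁, ht₁, hΨ⟩ := h₁ s hs hΦ
  obtain ⟨t₂, s₂, e₂, ht₂, hΧ⟩ := h₂ s₁ (e₁.fits hs) hΨ
  exact ⟨_, s₂, .seq e₁ e₂, by omega, hΧ⟩

theorem Triple.ite {μ : Arith} {B T : ℕ} {Φ Ψ : State → Prop} {b : Test} {p q : Prog}
    (h₁ : Triple μ B (fun s => Φ s ∧ b.holds s) p T Ψ)
    (h₂ : Triple μ B (fun s => Φ s ∧ ¬ b.holds s) q T Ψ) :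
    Triple μ B Φ (.ite b p q) (T + 1) Ψ := by
  intro s hs hΦ
  by_cases hb : b.holds s
  · obtain ⟨t, s', e, ht, hΨ⟩ := h₁ s hs ⟨hΦ, hb⟩
    exact ⟨_, s', .ite_true hb e, by omega, hΨ⟩
  · obtain ⟨t, s', e, ht, hΨ⟩ := h₂ s hs ⟨hΦ, hb⟩
    exact ⟨_, s', .ite_false hb e, by omega, hΨ⟩

/-- `Φ i` is the invariant after `i` rounds. A round costs its body and one test, and the last,
failing test adds 1. The induction is on the number of rounds still to come. -/
theorem Triple.loop {μ : Arith} {B T : ℕ} {b : Test} {p : Prog} (k : ℕ) (Φ : ℕ → State → Prop)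
    (htrue : ∀ i < k, ∀ s, Φ i s → b.holds s) (hfalse : ∀ s, Φ k s → ¬ b.holds s)
    (hp : ∀ i < k, Triple μ B (Φ i) p T (Φ (i + 1))) :
    Triple μ B (Φ 0) (.loop b p) (k * (T + 1) + 1) (Φ k) := by
  have key : ∀ j ≤ k, Triple μ B (Φ (k - j)) (.loop b p) (j * (T + 1) + 1) (Φ k) := by
    intro j
    induction j with
    | zero => exact fun _ s _ hΦ => ⟨1, s, .loop_false (hfalse s hΦ), by omega, hΦ⟩
    | succ j ih =>
      intro hj s hs hΦ
      obtain ⟨t₁, s₁, e₁, ht₁, h₁⟩ := hp (k - (j + 1)) (by omega) s hs hΦ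
      rw [show k - (j + 1) + 1 = k - j by omega] at h₁
      obtain ⟨t₂, s₂, e₂, ht₂, h₂⟩ := ih (by omega) s₁ (e₁.fits hs) h₁
      exact ⟨_, s₂, .loop_true (htrue _ (by omega) s hΦ) e₁ e₂, by rw [add_mul]; omega, h₂⟩
  simpa using key k le_rfl

theorem Triple.mono {μ : Arith} {B T T' : ℕ} {Φ Φ' Ψ Ψ' : State → Prop} {p : Prog}
    (h : Triple μ B Φ p T Ψ) (hΦ : ∀ s, Φ' s → Φ s) (hT : T ≤ T') (hΨ : ∀ s, Ψ s → Ψ' s) :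
    Triple μ B Φ' p T' Ψ' := by
  intro s hs hs'
  obtain ⟨t, s', e, ht, h'⟩ := h s hs (hΦ s hs')
  exact ⟨t, s', e, ht.trans hT, hΨ s' h'⟩

/-! ## Dominance under linear scoring functions -/

theorem fdominates_projections {d : ℕ} (x y : Point d) :
    FDominates (FDesc.projections d).toSet x y ↔ x ≠ y ∧ ∀ i, x i ≤ y i := by
  refine and_congr_right fun _ => ⟨fun h i => ?_, fun h f hf => ?_⟩
  · have := h (linearScore fun i' => if i' = i then 1 else 0) ⟨i, rfl⟩
    simpa [linearScore] using this
  · rw [FDesc.toSet_projections] at hf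
    obtain ⟨j, hj⟩ := hf
    rw [hj, hj]
    exact h j

/-- The unit vectors of the simplex give the projections; conversely, monotonicity of the scores is
enough. -/
theorem fdominates_allLinear {d : ℕ} (x y : Point d) :
    FDominates (FDesc.allLinear d).toSet x y ↔ x ≠ y ∧ ∀ i, x i ≤ y i := by
  refine and_congr_right fun _ => ⟨fun h i => ?_, fun h f _ => f.monotone h⟩
  have := h (linearScore fun i' => if i' = i then 1 else 0) (by
    rw [FDesc.toSet_allLinear]
    exact ⟨_, by simp, rfl⟩)
  simpa [linearScore] using this

/-! ## The uncertain dataset of a pair of sets of vectors -/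

section
variable {n d : ℕ}

/-- The vectors `a` become the points `2a`, the vectors `b` become the points `3 - 2b`. -/
def ovPoint (A B : Fin n → Fin d → Bool) : Fin (n + n) → Point d :=
  Fin.append (fun a i => if A a i then 2 else 0) (fun b i => if B b i then 1 else 3)

/-- Every `a` is an object of its own, the `b` form one object. -/
def ovObj : Fin (n + n) → Fin (n + 1) :=
  Fin.append Fin.castSucc (fun _ => Fin.last n)

def ovProb : Fin (n + n) → ℝ :=
  Fin.append (fun _ => 1) (fun _ => 1 / (n : ℝ))

theorem ovObj_castAdd (a : Fin n) : ovObj (Fin.castAdd n a) = a.castSucc := by simp [ovObj]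
theorem ovObj_natAdd (b : Fin n) : ovObj (Fin.natAdd n b) = Fin.last n := Fin.append_right ..
theorem ovProb_castAdd (a : Fin n) : ovProb (Fin.castAdd n a) = 1 := by simp [ovProb]
theorem ovProb_natAdd (b : Fin n) : ovProb (Fin.natAdd n b) = 1 / (n : ℝ) := Fin.append_right ..

/-- Since every object has full mass, a world that omits an object has a factor `1 - 1 = 0`. -/
theorem sum_ovProb (hn : 0 < n) (i : Fin (n + 1)) :
    ∑ t with ovObj t = i, (ovProb t : ℝ) = 1 := by
  rw [Finset.sum_filter, Fin.sum_univ_add]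
  simp only [ovObj_castAdd, ovObj_natAdd, ovProb_castAdd, ovProb_natAdd]
  have hn' : (n : ℝ) ≠ 0 := by positivity
  induction i using Fin.lastCases with
  | last => simp [Fin.castSucc_ne_last, hn']
  | cast i => simp [Fin.castSucc_inj, (Fin.castSucc_ne_last _).symm]

/-- Parity: the coordinates are 0 or 2 on one side, 1 or 3 on the other. At least one coordinate is
needed. -/
theorem ovPoint_castAdd_ne_natAdd (hd : 0 < d) (A B : Fin n → Fin d → Bool) (a b : Fin n) :
    ovPoint A B (Fin.castAdd n a) ≠ ovPoint A B (Fin.natAdd n b) := by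
  intro h
  have := congrFun h ⟨0, hd⟩
  simp only [ovPoint, Fin.append_left, Fin.append_right] at this
  split_ifs at this <;> simp at this

theorem ovPoint_injective (hd : 0 < d) {A B : Fin n → Fin d → Bool} (hA : A.Injective)
    (hB : B.Injective) : (ovPoint A B).Injective := by
  intro s t h
  induction s using Fin.addCases with
  | left a =>
    induction t using Fin.addCases with
    | left a' =>
      congr 1
      apply hA
      ext1 i
      have := congrFun h i
      simp only [ovPoint, Fin.append_left] at this
      split_ifs at this <;> simp_all
    | right b => exact absurd h (ovPoint_castAdd_ne_natAdd hd A B a b)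
  | right b =>
    induction t using Fin.addCases with
    | left a => exact absurd h.symm (ovPoint_castAdd_ne_natAdd hd A B a b)
    | right b' =>
      congr 1
      apply hB
      ext1 i
      have := congrFun h i
      simp only [ovPoint, Fin.append_right] at this
      split_ifs at this <;> simp_all

/-- The uncertain dataset that encodes an orthogonal vectors instance. -/
def ovDataset (hn : 0 < n) (hd : 0 < d) {A B : Fin n → Fin d → Bool} (hA : A.Injective)
    (hB : B.Injective) : UncertainDataset (n + n) (n + 1) d where
  point := ovPoint A B
  point_injective := ovPoint_injective hd hA hB
  obj := ovObj
  obj_surjective i := by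
    induction i using Fin.lastCases with
    | last => exact ⟨Fin.natAdd n ⟨0, hn⟩, ovObj_natAdd _⟩
    | cast i => exact ⟨Fin.castAdd n i, ovObj_castAdd _⟩
  prob := ovProb
  prob_nonneg t := by
    induction t using Fin.addCases with
    | left a => simp [ovProb_castAdd]
    | right b => rw [ovProb_natAdd]; positivity
  sum_prob_le_one i := (sum_ovProb hn i).le

/-- The possible world in which `b` represents the second set. -/
def ovWorld (b : Fin n) : Finset (Fin (n + n)) :=
  insert (Fin.natAdd n b) (Finset.univ.image (Fin.castAdd n))

theorem castAdd_mem_ovWorld (a b : Fin n) : Fin.castAdd n a ∈ ovWorld b := by simp [ovWorld]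

theorem castAdd_ne_natAdd (a b : Fin n) : Fin.castAdd n a ≠ Fin.natAdd n b := by
  intro h
  have := congrArg Fin.val h
  simp at this
  omega

theorem natAdd_mem_ovWorld {b b' : Fin n} : Fin.natAdd n b' ∈ ovWorld b ↔ b' = b := by
  simp [-Fin.natAdd_eq_addNat, ovWorld, castAdd_ne_natAdd]

/-! ### Possible worlds and rskyline probabilities of the encoding -/

section
variable (hn : 0 < n) (hd : 0 < d) {A B : Fin n → Fin d → Bool} (hA : A.Injective)
  (hB : B.Injective)

theorem ovWorld_mem_worlds (b : Fin n) : ovWorld b ∈ (ovDataset hn hd hA hB).worlds := by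
  simp only [UncertainDataset.worlds, Finset.mem_filter, Finset.mem_univ, true_and]
  intro s hs t ht h
  simp only [Finset.mem_coe] at hs ht
  change ovObj s = ovObj t at h
  induction s using Fin.addCases with
  | left a =>
    induction t using Fin.addCases with
    | left a' => simpa [ovObj_castAdd] using h
    | right b => simp [-Fin.natAdd_eq_addNat, ovObj_castAdd, ovObj_natAdd, 
        Fin.castSucc_ne_last] at h
  | right b =>
    induction t using Fin.addCases with
    | left a => simp [-Fin.natAdd_eq_addNat, ovObj_castAdd, ovObj_natAdd,
        (Fin.castSucc_ne_last _).symm] at h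
    | right b' => rw [natAdd_mem_ovWorld.1 hs, natAdd_mem_ovWorld.1 ht]

theorem worldProb_ovWorld (b : Fin n) : (ovDataset hn hd hA hB).worldProb (ovWorld b) = 1 / n := by
  classical
  unfold UncertainDataset.worldProb
  have h₂ : ({i | ∀ t ∈ ovWorld b, (ovDataset hn hd hA hB).obj t ≠ i} : Finset (Fin (n + 1))) =
      ∅ := by
    refine Finset.filter_eq_empty_iff.2 fun i _ h => ?_
    induction i using Fin.lastCases with
    | last => exact h _ (natAdd_mem_ovWorld.2 rfl) (ovObj_natAdd b)
    | cast i => exact h _ (castAdd_mem_ovWorld i b) (ovObj_castAdd i)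
  have h₁ : ∏ t ∈ ovWorld b, (ovDataset hn hd hA hB).prob t = 1 / n := by
    change ∏ t ∈ ovWorld b, ovProb t = _
    rw [ovWorld, Finset.prod_insert (by simp [-Fin.natAdd_eq_addNat, castAdd_ne_natAdd]),
      Finset.prod_image (Fin.castAdd_injective n n).injOn, ovProb_natAdd]
    simp [ovProb_castAdd]
  rw [h₁]
  convert mul_one _
  convert Finset.prod_empty

/-- Every object must be represented. This forces all of `A` into `D`, while injectivity of the
object map on `D` leaves room for only one `b`. -/
theorem eq_ovWorld_of_worldProb_ne_zero {D : Finset (Fin (n + n))}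
    (hD : D ∈ (ovDataset hn hd hA hB).worlds)
    (h : (ovDataset hn hd hA hB).worldProb D ≠ 0) : ∃ b, D = ovWorld b := by
  classical
  unfold UncertainDataset.worldProb at h
  have h' := Finset.prod_ne_zero_iff.1 (right_ne_zero_of_mul h)
  have hex : ∀ i, ∃ t ∈ D, ovObj t = i := by
    intro i
    by_contra! hi
    refine h' i (Finset.mem_filter.2 ⟨Finset.mem_univ _, hi⟩) ?_
    have := sum_ovProb hn i
    change 1 - ∑ t with ovObj t = i, ovProb t = 0
    rw [← this]
    convert sub_self _
  simp only [UncertainDataset.worlds, Finset.mem_filter, Finset.mem_univ, true_and] at hD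
  obtain ⟨t, htD, ht⟩ := hex (Fin.last n)
  obtain ⟨b, rfl⟩ : ∃ b, t = Fin.natAdd n b := by
    induction t using Fin.addCases with
    | left a => simp [ovObj_castAdd, Fin.castSucc_ne_last] at ht
    | right b => exact ⟨b, rfl⟩
  refine ⟨b, ?_⟩
  ext s
  induction s using Fin.addCases with
  | left a =>
    refine iff_of_true ?_ (castAdd_mem_ovWorld a b)
    obtain ⟨s, hsD, hs⟩ := hex a.castSucc
    induction s using Fin.addCases with
    | left a' =>
      rw [ovObj_castAdd, Fin.castSucc_inj] at hs
      exact hs ▸ hsD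
    | right b => simp [-Fin.natAdd_eq_addNat, ovObj_natAdd, (Fin.castSucc_ne_last _).symm] at hs
  | right b' =>
    rw [natAdd_mem_ovWorld]
    refine ⟨fun hb' => ?_, fun e => e ▸ htD⟩
    have : Fin.natAdd n b' = Fin.natAdd n b := hD hb' htD (by
      change ovObj _ = ovObj _
      rw [ovObj_natAdd, ovObj_natAdd])
    simpa using this

open Classical in
theorem rskyProb_ovDataset (F : Set (ScoringFn d)) (t : Fin (n + n)) :
    (ovDataset hn hd hA hB).rskyProb F t =
      (Finset.card {b : Fin n |
        ovPoint A B t ∈ rsky (ovPoint A B '' (ovWorld b : Set (Fin (n + n)))) F} : ℝ) / n := by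
  have hinj : Function.Injective (ovWorld : Fin n → _) := fun b b' h =>
    natAdd_mem_ovWorld.1 (h ▸ natAdd_mem_ovWorld.2 rfl)
  unfold UncertainDataset.rskyProb
  rw [← Finset.sum_subset (s₁ := Finset.univ.image ovWorld), Finset.sum_image hinj.injOn]
  · simp only [worldProb_ovWorld]
    rw [← Finset.mul_sum, Finset.sum_boole]
    rw [one_div, inv_mul_eq_div]
    rfl
  · intro D hD
    obtain ⟨b, -, rfl⟩ := Finset.mem_image.1 hD
    exact ovWorld_mem_worlds ..
  · intro D hD hD'
    by_contra h
    obtain ⟨b, rfl⟩ := eq_ovWorld_of_worldProb_ne_zero hn hd hA hB hD (left_ne_zero_of_mul h)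
    exact hD' (by simp)

theorem rskyProb_natAdd_eq_zero_iff {F : Set (ScoringFn d)}
    (hF : ∀ x y : Point d, FDominates F x y ↔ x ≠ y ∧ ∀ i, x i ≤ y i) (b : Fin n) :
    (ovDataset hn hd hA hB).rskyProb F (Fin.natAdd n b) = 0 ↔
      ∃ a, ∑ i, (A a i).toNat * (B b i).toNat = 0 := by
  classical
  have hdom : ∀ a, FDominates F (ovPoint A B (Fin.castAdd n a)) (ovPoint A B (Fin.natAdd n b)) ↔
      ∑ i, (A a i).toNat * (B b i).toNat = 0 := by
    intro a
    rw [hF, and_iff_right (ovPoint_castAdd_ne_natAdd hd A B a b), Finset.sum_eq_zero_iff]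
    simp only [Finset.mem_univ, true_imp_iff]
    refine forall_congr' fun i => ?_
    simp only [ovPoint, Fin.append_left, Fin.append_right]
    -- The four comparisons are `0 ≤ 3`, `0 ≤ 1`, `2 ≤ 3` and `2 ≤ 1`; only the last fails.
    cases A a i <;> cases B b i <;> norm_num
  have hn' : (n : ℝ) ≠ 0 := by positivity
  rw [rskyProb_ovDataset, div_eq_zero_iff, or_iff_left hn', Nat.cast_eq_zero,
    Finset.card_eq_zero, Finset.filter_eq_empty_iff]
  constructor
  · intro h
    -- In the world of `b` itself the point is present, hence dominated; no other `b'` is there, so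
    -- an `a` dominates it.
    have := h (Finset.mem_univ b)
    simp only [rsky, Set.mem_ofPred_eq, not_and, not_not] at this
    obtain ⟨y, ⟨t, ht, rfl⟩, hy⟩ := this ⟨_, natAdd_mem_ovWorld.2 rfl, rfl⟩
    induction t using Fin.addCases with
    | left a => exact ⟨a, (hdom a).1 hy⟩
    | right b' =>
      rw [natAdd_mem_ovWorld.1 ht] at hy
      exact absurd rfl hy.1
  · rintro ⟨a, ha⟩ b' -
    rintro ⟨-, h⟩
    exact h ⟨_, ⟨_, castAdd_mem_ovWorld a b', rfl⟩, (hdom a).2 ha⟩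

/-- The probabilities are counts out of `n`. In the bounded reading, `P` is only required to succeed
when its outputs are this small. -/
theorem fitsData_rskyProb_ovDataset {μ : Arith} {M : ℕ} (hM : n ≤ M) (F : Set (ScoringFn d))
    (t : Fin (n + n)) : FitsData μ M ((ovDataset hn hd hA hB).rskyProb F t) := by
  classical
  rw [rskyProb_ovDataset]
  refine FitsData.natCast_div ((Finset.card_le_univ _).trans ?_) hM (hn.trans_le hM)
  simpa using hM

end

end

/-! ## The reduction as a program -/

theorem Triple.count {μ : Arith} {B T x y a b : ℕ} {p : Prog} (hab : a ≤ b)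
    (Φ : ℕ → State → Prop) (hreg : ∀ i s, Φ i s → s.wreg x = i ∧ s.wreg y = b)
    (hp : ∀ i, a ≤ i → i < b → Triple μ B (Φ i) p T (Φ (i + 1))) :
    Triple μ B (Φ a) (.loop (.wlt x y) p) ((b - a) * (T + 1) + 1) (Φ b) := by
  have := Triple.loop (μ := μ) (B := B) (T := T) (b := .wlt x y) (p := p) (b - a)
    (fun i => Φ (a + i))
    (fun i hi s hs => by
      obtain ⟨h₁, h₂⟩ := hreg _ _ hs
      simp only [Test.holds]; omega)
    (fun s hs => by
      obtain ⟨h₁, h₂⟩ := hreg _ _ hs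
      simp only [Test.holds]; omega)
    (fun i hi => hp (a + i) (by omega) (by omega))
  simpa [Nat.add_sub_cancel' hab] using this

/-- `f` vanishes below `R`. -/
def ZeroBelow {α : Type*} [Zero α] (R : ℕ) (f : ℕ → α) : Prop := ∀ x < R, f x = 0

theorem zeroBelow_update {α : Type*} [Zero α] {R i : ℕ} {f : ℕ → α} {v : α} (hi : R ≤ i) :
    ZeroBelow R (Function.update f i v) ↔ ZeroBelow R f :=
  forall₂_congr fun x hx => by rw [Function.update_of_ne (by omega)]

/-- The restriction of `f` to the arguments below `k`, continued by zero. -/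
def upto {α : Type*} [Zero α] (k : ℕ) (f : ℕ → α) : ℕ → α := fun x => if x < k then f x else 0

theorem update_upto {α : Type*} [Zero α] {k : ℕ} {f : ℕ → α} {v : α} (hv : v = f k) :
    Function.update (upto k f) k v = upto (k + 1) f := by
  ext x
  simp only [Function.update_apply, upto]
  split_ifs <;> first | rfl | omega | simp_all

/-- Cells whose final value is zero need not be written, because the data memory starts out zero. -/
theorem upto_eq_upto {α : Type*} [Zero α] {k l : ℕ} {f : ℕ → α} (h : k ≤ l)
    (hf : ∀ x, k ≤ x → x < l → f x = 0) : upto k f = upto l f := by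
  ext x
  simp only [upto]
  split_ifs <;> first | rfl | omega | (symm; apply hf <;> omega)

theorem upto_eq_self {α : Type*} [Zero α] {k : ℕ} {f : ℕ → α} (hf : ∀ x, k ≤ x → f x = 0) :
    upto k f = f := by
  ext x
  simp only [upto]
  split_ifs with h
  · rfl
  · exact (hf x (by omega)).symm

/-- `w` with the `i` cells from number 2 on set to zero. -/
def cleared (i : ℕ) (w : ℕ → ℕ) : ℕ → ℕ := fun x => if 2 ≤ x ∧ x < 2 + i then 0 else w x

theorem update_cleared (i : ℕ) (w : ℕ → ℕ) :
    Function.update (cleared i w) (2 + i) 0 = cleared (i + 1) w := by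
  ext x
  simp only [Function.update_apply, cleared]
  split_ifs <;> first | rfl | omega

/-- The state in the reduction when the memories contain `wm` and `dm`, the counter is `i` and its
limit is `l`. -/
def Loaded (R n d : ℕ) (wm : ℕ → ℕ) (dm : ℕ → ℝ) (i l : ℕ) (s : State) : Prop :=
  ZeroBelow R s.wreg ∧ ZeroBelow R s.dreg ∧ s.wreg R = n ∧ s.wreg (R + 1) = d ∧
    s.wreg (R + 2) = 1 ∧ s.dreg R = 1 ∧ s.dreg (R + 1) = 1 / (n : ℝ) ∧
    s.wreg (R + 3) = i ∧ s.wreg (R + 4) = l ∧ s.wmem = wm ∧ s.dmem = dm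

namespace Reduction

/-- Register `R + 5` is still zero, so the first load reads `n` from address 0; the second reads `d`
from address 1. -/
def start (R : ℕ) : List Instr :=
  [.wconst (R + 2) 1, .wload R (R + 5), .wload (R + 1) (R + 2), .dcast R (R + 2),
    .dcast (R + 2) R, .dop .div (R + 1) R (R + 2), .wop .mul (R + 4) R (R + 1)]

/-- The source cell is erased after use: `P` must find nothing but its own input in the word memory.
-/
def copyFirst (R : ℕ) : List Instr :=
  [.wconst (R + 5) 2, .wop .add (R + 5) (R + 5) (R + 3), .wload (R + 6) (R + 5),
    .wop .add (R + 6) (R + 6) (R + 6), .dcast (R + 2) (R + 6), .dstore (R + 3) (R + 2),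
    .wconst (R + 6) 0, .wstore (R + 5) (R + 6), .wop .add (R + 3) (R + 3) (R + 2)]

def copySecond (R : ℕ) : List Instr :=
  [.wconst (R + 5) 2, .wop .add (R + 5) (R + 5) (R + 3), .wload (R + 6) (R + 5),
    .wop .add (R + 6) (R + 6) (R + 6), .wconst (R + 7) 3, .wop .sub (R + 6) (R + 7) (R + 6),
    .dcast (R + 2) (R + 6), .dstore (R + 3) (R + 2),
    .wconst (R + 6) 0, .wstore (R + 5) (R + 6), .wop .add (R + 3) (R + 3) (R + 2)]

def addProduct (R : ℕ) : List Instr :=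
  [.wop .mul (R + 5) R (R + 1), .wop .add (R + 4) (R + 4) (R + 5)]

def addLength (R : ℕ) : List Instr := [.wop .add (R + 4) (R + 4) R]

def putData (R r : ℕ) : List Instr := [.dstore (R + 3) r, .wop .add (R + 3) (R + 3) (R + 2)]

/-- Diagonal entries of a `d × d` matrix are `d + 1` cells apart. The limit is thus `q * d` strides
of `d + 1` ahead, slightly past the end of the matrix; the stride stays in register `R + 6`. -/
def addSquare (R q : ℕ) : List Instr :=
  [.wconst (R + 5) q, .wop .mul (R + 5) (R + 5) (R + 1), .wop .add (R + 6) (R + 1) (R + 2),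
    .wop .mul (R + 5) (R + 5) (R + 6), .wop .add (R + 4) (R + 4) (R + 5)]

def putDiagonal (R : ℕ) : List Instr :=
  [.dstore (R + 3) R, .wop .add (R + 3) (R + 3) (R + 6)]

/-- The fourth word `1 - q` is the kind of the description: 0 for a list of functions, 1 for
constraints. -/
def header (R q : ℕ) : List Instr :=
  [.wconst (R + 5) 0, .wop .add (R + 6) R R, .wstore (R + 5) (R + 6),
    .wop .add (R + 6) R (R + 2), .wstore (R + 2) (R + 6),
    .wconst (R + 5) 2, .wstore (R + 5) (R + 1),
    .wconst (R + 5) 3, .wconst (R + 6) (1 - q), .wstore (R + 5) (R + 6),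
    .wconst (R + 5) 4, .wconst (R + 6) q, .wop .mul (R + 6) (R + 6) (R + 1),
    .wstore (R + 5) (R + 6),
    .wconst (R + 3) 5, .wop .add (R + 4) (R + 3) R]

def putName (R : ℕ) : List Instr :=
  [.wconst (R + 5) 5, .wop .sub (R + 6) (R + 3) (R + 5), .wstore (R + 3) (R + 6),
    .wop .add (R + 3) (R + 3) (R + 2)]

def putLast (R : ℕ) : List Instr := [.wstore (R + 3) R, .wop .add (R + 3) (R + 3) (R + 2)]

/-- Loop while the counter is below its limit. -/
def repeatUntil (R : ℕ) (l : List Instr) : Prog := .loop (.wlt (R + 3) (R + 4)) (.block l)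

end Reduction

/-! ### Correctness and running time of the loading phase -/

section
variable {μ : Arith} {B R n d : ℕ}

theorem Loaded.hreg {wm : ℕ → ℕ → ℕ} {dm : ℕ → ℕ → ℝ} {l : ℕ} (i : ℕ) (s : State)
    (h : Loaded R n d (wm i) (dm i) i l s) : s.wreg (R + 3) = i ∧ s.wreg (R + 4) = l :=
  ⟨h.2.2.2.2.2.2.2.1, h.2.2.2.2.2.2.2.2.1⟩

theorem start_triple (hB : 1 ≤ B) {w : ℕ → ℕ} (hw₀ : w 0 = n) (hw₁ : w 1 = d) (hn : n ≤ B)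
    (hnd : n * d ≤ B) :
    Triple μ B (fun s => s.wreg = 0 ∧ s.dreg = 0 ∧ s.wmem = w ∧ s.dmem = 0)
      (.block (Reduction.start R)) 7 (Loaded R n d w 0 0 (n * d)) := by
  refine Triple.block hB _ fun s hs ⟨h₁, h₂, h₃, h₄⟩ => ?_
  have z : ZeroBelow R (0 : ℕ → ℕ) := fun _ _ => rfl
  have z' : ZeroBelow R (0 : ℕ → ℝ) := fun _ _ => rfl
  have hf : FitsData μ B (n : ℝ)⁻¹ := by
    simpa using FitsData.natCast_div (μ := μ) (k := 1) hB hn hB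
  simp [Reduction.start, Instr.OkThen, Instr.Ok, Instr.apply, WordOp.eval, DataOp.eval, Loaded,
    zeroBelow_update, *]

theorem copyFirst_triple (hB : 3 ≤ B) {w : ℕ → ℕ} {G : ℕ → ℝ} {i l : ℕ} (hi : 2 + i ≤ B)
    (hw : w (2 + i) ≤ 1) (hG : G i = ((w (2 + i) + w (2 + i) : ℕ) : ℝ)) :
    Triple μ B (Loaded R n d (cleared i w) (upto i G) i l) (.block (Reduction.copyFirst R)) 9
      (Loaded R n d (cleared (i + 1) w) (upto (i + 1) G) (i + 1) l) := by
  refine Triple.block (by omega) _ fun s hs ⟨z, z', h₁, h₂, h₃, h₄, h₅, h₆, h₇, h₈, h₉⟩ => ?_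
  have hc : cleared i w (2 + i) = w (2 + i) := by simp [cleared]
  have hu := update_upto hG.symm
  push_cast at hu
  simp [Reduction.copyFirst, Instr.OkThen, Instr.Ok, Instr.apply, WordOp.eval, Loaded,
    zeroBelow_update, update_cleared, -one_div, *]
  omega

theorem copySecond_triple (hB : 3 ≤ B) {w : ℕ → ℕ} {G : ℕ → ℝ} {i l : ℕ} (hi : 2 + i ≤ B)
    (hw : w (2 + i) ≤ 1) (hG : G i = ((3 - (w (2 + i) + w (2 + i)) : ℕ) : ℝ)) :
    Triple μ B (Loaded R n d (cleared i w) (upto i G) i l) (.block (Reduction.copySecond R)) 11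
      (Loaded R n d (cleared (i + 1) w) (upto (i + 1) G) (i + 1) l) := by
  refine Triple.block (by omega) _ fun s hs ⟨z, z', h₁, h₂, h₃, h₄, h₅, h₆, h₇, h₈, h₉⟩ => ?_
  have hc : cleared i w (2 + i) = w (2 + i) := by simp [cleared]
  have hu := update_upto hG.symm
  simp [Reduction.copySecond, Instr.OkThen, Instr.Ok, Instr.apply, WordOp.eval, Loaded,
    zeroBelow_update, update_cleared, -one_div, -Nat.cast_ofNat, *]
  omega

theorem addProduct_triple (hB : 1 ≤ B) {wm : ℕ → ℕ} {dm : ℕ → ℝ} {i l : ℕ}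
    (hl : l + n * d ≤ B) :
    Triple μ B (Loaded R n d wm dm i l) (.block (Reduction.addProduct R)) 2
      (Loaded R n d wm dm i (l + n * d)) := by
  refine Triple.block hB _ fun s hs ⟨z, z', h₁, h₂, h₃, h₄, h₅, h₆, h₇, h₈, h₉⟩ => ?_
  simp [Reduction.addProduct, Instr.OkThen, Instr.Ok, Instr.apply, WordOp.eval, Loaded,
    zeroBelow_update, *]
  omega

theorem addLength_triple (hB : 1 ≤ B) {wm : ℕ → ℕ} {dm : ℕ → ℝ} {i l : ℕ} (hl : l + n ≤ B) :
    Triple μ B (Loaded R n d wm dm i l) (.block (Reduction.addLength R)) 1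
      (Loaded R n d wm dm i (l + n)) := by
  refine Triple.block hB _ fun s hs ⟨z, z', h₁, h₂, h₃, h₄, h₅, h₆, h₇, h₈, h₉⟩ => ?_
  simp [Reduction.addLength, Instr.OkThen, Instr.Ok, Instr.apply, WordOp.eval, Loaded,
    zeroBelow_update, *]

theorem putData_triple (hB : 1 ≤ B) {wm : ℕ → ℕ} {G : ℕ → ℝ} {i l r : ℕ} (hi : i + 1 ≤ B)
    (hr : ∀ s, Loaded R n d wm (upto i G) i l s → s.dreg r = G i) :
    Triple μ B (Loaded R n d wm (upto i G) i l) (.block (Reduction.putData R r)) 2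
      (Loaded R n d wm (upto (i + 1) G) (i + 1) l) := by
  refine Triple.block hB _ fun s hs h => ?_
  have hr := hr s h
  obtain ⟨z, z', h₁, h₂, h₃, h₄, h₅, h₆, h₇, h₈, h₉⟩ := h
  simp [Reduction.putData, Instr.OkThen, Instr.Ok, Instr.apply, WordOp.eval, Loaded,
    zeroBelow_update, update_upto, *]

theorem addSquare_triple (hB : 1 ≤ B) {wm : ℕ → ℕ} {dm : ℕ → ℝ} {i l q : ℕ} (hq : q ≤ 1)
    (hl : l + d * (d + 1) ≤ B) :
    Triple μ B (Loaded R n d wm dm i l) (.block (Reduction.addSquare R q)) 5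
      (fun s => Loaded R n d wm dm i (l + q * d * (d + 1)) s ∧ s.wreg (R + 6) = d + 1) := by
  refine Triple.block hB _ fun s hs ⟨z, z', h₁, h₂, h₃, h₄, h₅, h₆, h₇, h₈, h₉⟩ => ?_
  have hd : d ≤ B := h₂ ▸ hs.1 _
  have h₁₀ : d + 1 ≤ B := by
    rcases Nat.eq_zero_or_pos d with rfl | hd0
    · omega
    · nlinarith
  simp [Reduction.addSquare, Instr.OkThen, Instr.Ok, Instr.apply, WordOp.eval, Loaded,
    zeroBelow_update, *]
  interval_cases q <;> simp <;> omega

theorem putDiagonal_triple (hB : 1 ≤ B) {wm : ℕ → ℕ} {G : ℕ → ℝ} {i l : ℕ}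
    (hi : i + (d + 1) ≤ B) (hG : G i = 1) (hG' : ∀ r < d, G (i + r + 1) = 0) :
    Triple μ B (fun s => Loaded R n d wm (upto i G) i l s ∧ s.wreg (R + 6) = d + 1)
      (.block (Reduction.putDiagonal R)) 2
      (fun s => Loaded R n d wm (upto (i + (d + 1)) G) (i + (d + 1)) l s ∧
        s.wreg (R + 6) = d + 1) := by
  refine Triple.block hB _ fun s hs ⟨⟨z, z', h₁, h₂, h₃, h₄, h₅, h₆, h₇, h₈, h₉⟩, h₁₀⟩ => ?_
  -- A single write settles `d + 1` cells, since `G` vanishes on the `d` cells after the diagonal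
  -- one.
  have hu : Function.update (upto i G) i 1 = upto (i + (d + 1)) G := by
    rw [update_upto hG.symm]
    refine upto_eq_upto (by omega) fun x hx hx' => ?_
    have := hG' (x - i - 1) (by omega)
    rwa [show i + (x - i - 1) + 1 = x by omega] at this
  simp [Reduction.putDiagonal, Instr.OkThen, Instr.Ok, Instr.apply, WordOp.eval, Loaded,
    zeroBelow_update, *]

theorem header_triple (hB : 5 ≤ B) {w H : ℕ → ℕ} {dm : ℕ → ℝ} {i l q : ℕ} (hq : q ≤ 1)
    (hn : n + n + 5 ≤ B) (hw : ∀ x, 2 ≤ x → w x = 0) (hH₀ : H 0 = n + n) (hH₁ : H 1 = n + 1)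
    (hH₂ : H 2 = d) (hH₃ : H 3 = 1 - q) (hH₄ : H 4 = q * d) :
    Triple μ B (Loaded R n d w dm i l) (.block (Reduction.header R q)) 16
      (Loaded R n d (upto 5 H) dm 5 (5 + n)) := by
  refine Triple.block (by omega) _ fun s hs ⟨z, z', h₁, h₂, h₃, h₄, h₅, h₆, h₇, h₈, h₉⟩ => ?_
  have hd : d ≤ B := h₂ ▸ hs.1 _
  have hqd : q * d ≤ B := by interval_cases q <;> simp [hd]
  have hu : Function.update (Function.update (Function.update (Function.update
      (Function.update w 0 (n + n)) 1 (n + 1)) 2 d) 3 (1 - q)) 4 (q * d) = upto 5 H := by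
    ext x
    rcases x with _ | _ | _ | _ | _ | x <;> simp [upto, *]
  simp [Reduction.header, Instr.OkThen, Instr.Ok, Instr.apply, WordOp.eval, Loaded,
    zeroBelow_update, *]
  omega

theorem putName_triple (hB : 5 ≤ B) {H : ℕ → ℕ} {dm : ℕ → ℝ} {i l : ℕ} (hi : i + 1 ≤ B)
    (hH : H i = i - 5) :
    Triple μ B (Loaded R n d (upto i H) dm i l) (.block (Reduction.putName R)) 4
      (Loaded R n d (upto (i + 1) H) dm (i + 1) l) := by
  refine Triple.block (by omega) _ fun s hs ⟨z, z', h₁, h₂, h₃, h₄, h₅, h₆, h₇, h₈, h₉⟩ => ?_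
  have hu := update_upto hH.symm
  simp [Reduction.putName, Instr.OkThen, Instr.Ok, Instr.apply, WordOp.eval, Loaded,
    zeroBelow_update, *]
  omega

theorem putLast_triple (hB : 1 ≤ B) {H : ℕ → ℕ} {dm : ℕ → ℝ} {i l : ℕ} (hi : i + 1 ≤ B)
    (hH : H i = n) :
    Triple μ B (Loaded R n d (upto i H) dm i l) (.block (Reduction.putLast R)) 2
      (Loaded R n d (upto (i + 1) H) dm (i + 1) l) := by
  refine Triple.block hB _ fun s hs ⟨z, z', h₁, h₂, h₃, h₄, h₅, h₆, h₇, h₈, h₉⟩ => ?_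
  have hu := update_upto hH.symm
  simp [Reduction.putLast, Instr.OkThen, Instr.Ok, Instr.apply, WordOp.eval, Loaded,
    zeroBelow_update, *]

/-- Turns an orthogonal vectors instance into an uncertain dataset. The description of the scoring
functions consists of `d` projections for `q = 1` and of no constraints for `q = 0`. -/
def Reduction.load (R q : ℕ) : Prog :=
  .seq (.block (start R)) <| .seq (repeatUntil R (copyFirst R)) <|
  .seq (.block (addProduct R)) <| .seq (repeatUntil R (copySecond R)) <|
  .seq (.block (addLength R)) <| .seq (repeatUntil R (putData R R)) <|
  .seq (.block (addLength R)) <| .seq (repeatUntil R (putData R (R + 1))) <|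
  .seq (.block (addSquare R q)) <| .seq (repeatUntil R (putDiagonal R)) <|
  .seq (.block (header R q)) <| .seq (repeatUntil R (putName R)) <|
  .seq (.block (addLength R)) <| repeatUntil R (putLast R)

/-- `w` is the initial word memory; `G` and `H` are the desired data and word memories, prescribed
block by block. The time is the sum over the pieces: 10 and 12 steps per attribute of the two sets,
3 + 3 for the two probabilities, 5 + 3 for the two object names, 3 per weight vector, and 40 outside
the rounds. -/
theorem load_triple {w H : ℕ → ℕ} {G : ℕ → ℝ} {q : ℕ} (hq : q ≤ 1)
    (hB : n * d + n * d + n + n + d * (d + 1) + 10 ≤ B)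
    (hw₀ : w 0 = n) (hw₁ : w 1 = d) (hw : ∀ x, w (2 + x) ≤ 1)
    (hw' : ∀ x, n * d + n * d ≤ x → w (2 + x) = 0)
    (hG₁ : ∀ i < n * d, G i = ((w (2 + i) + w (2 + i) : ℕ) : ℝ))
    (hG₂ : ∀ i < n * d, G (n * d + i) =
      ((3 - (w (2 + (n * d + i)) + w (2 + (n * d + i))) : ℕ) : ℝ))
    (hG₃ : ∀ i < n, G (n * d + n * d + i) = 1)
    (hG₄ : ∀ i < n, G (n * d + n * d + n + i) = 1 / (n : ℝ))
    (hG₅ : ∀ j < q * d, G (n * d + n * d + n + n + j * (d + 1)) = 1)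
    (hG₆ : ∀ j < q * d, ∀ r < d, G (n * d + n * d + n + n + j * (d + 1) + r + 1) = 0)
    (hG₇ : ∀ x, n * d + n * d + n + n + q * d * (d + 1) ≤ x → G x = 0)
    (hH₀ : H 0 = n + n) (hH₁ : H 1 = n + 1) (hH₂ : H 2 = d) (hH₃ : H 3 = 1 - q)
    (hH₄ : H 4 = q * d) (hH₅ : ∀ t < n, H (5 + t) = t) (hH₆ : ∀ t < n, H (5 + n + t) = n)
    (hH₇ : ∀ x, 5 + n + n ≤ x → H x = 0) :
    Triple μ B (fun s => s.wreg = 0 ∧ s.dreg = 0 ∧ s.wmem = w ∧ s.dmem = 0)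
      (Reduction.load R q) (22 * (n * d) + 14 * n + 3 * d + 40)
      (Loaded R n d H G (5 + n + n) (5 + n + n)) := by
  have hqd : q * d * (d + 1) ≤ d * (d + 1) := by interval_cases q <;> simp
  have hqd' : q * d ≤ d := by interval_cases q <;> simp
  -- With the product named, the address arithmetic is linear and within reach of `omega`.
  generalize hP : n * d = m at *
  have t₁ : Triple μ B (fun s => s.wreg = 0 ∧ s.dreg = 0 ∧ s.wmem = w ∧ s.dmem = 0)
      (.block (Reduction.start R)) 7 (Loaded R n d (cleared 0 w) (upto 0 G) 0 m) := by
    have hm : m ≤ B := by omega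
    rw [← hP] at hm
    convert start_triple (μ := μ) (R := R) (by omega) hw₀ hw₁ (by omega) hm using 2
    · funext x; simp only [cleared]; split_ifs <;> first | rfl | omega
    · funext x; simp [upto]
    · exact hP.symm
  have t₂ := Triple.count (μ := μ) (B := B) (Nat.zero_le m)
    (fun i => Loaded R n d (cleared i w) (upto i G) i m) Loaded.hreg
    (fun i hi hi' => copyFirst_triple (by omega) (by omega) (hw i) (hG₁ i hi'))
  have t₃ := addProduct_triple (μ := μ) (R := R) (n := n) (d := d) (show 1 ≤ B by omega)
    (wm := cleared m w) (dm := upto m G) (i := m) (l := m) (by omega)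
  rw [hP] at t₃
  have t₄ := Triple.count (μ := μ) (B := B) (Nat.le_add_right m m)
    (fun i => Loaded R n d (cleared i w) (upto i G) i (m + m)) Loaded.hreg
    (fun i hi hi' => copySecond_triple (by omega) (by omega) (hw i) (by
      simpa [Nat.add_sub_cancel' hi] using hG₂ (i - m) (by omega)))
  have t₅ := addLength_triple (μ := μ) (R := R) (n := n) (d := d) (show 1 ≤ B by omega)
    (wm := cleared (m + m) w) (dm := upto (m + m) G) (i := m + m) (l := m + m) (by omega)
  have t₆ := Triple.count (μ := μ) (B := B) (Nat.le_add_right (m + m) n)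
    (fun i => Loaded R n d (cleared (m + m) w) (upto i G) i (m + m + n)) Loaded.hreg
    (fun i hi hi' => putData_triple (r := R) (by omega) (by omega) fun s hs => by
      rw [hs.2.2.2.2.2.1]
      simpa [Nat.add_sub_cancel' hi] using (hG₃ (i - (m + m)) (by omega)).symm)
  have t₇ := addLength_triple (μ := μ) (R := R) (n := n) (d := d) (show 1 ≤ B by omega)
    (wm := cleared (m + m) w) (dm := upto (m + m + n) G) (i := m + m + n) (l := m + m + n)
    (by omega)
  have t₈ := Triple.count (μ := μ) (B := B) (Nat.le_add_right (m + m + n) n)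
    (fun i => Loaded R n d (cleared (m + m) w) (upto i G) i (m + m + n + n)) Loaded.hreg
    (fun i hi hi' => putData_triple (r := R + 1) (by omega) (by omega) fun s hs => by
      rw [hs.2.2.2.2.2.2.1]
      simpa [Nat.add_sub_cancel' hi] using (hG₄ (i - (m + m + n)) (by omega)).symm)
  generalize hb : m + m + n + n = b at *
  have t₉ := addSquare_triple (μ := μ) (R := R) (n := n) (d := d) (show 1 ≤ B by omega)
    (wm := cleared (m + m) w) (dm := upto b G) (i := b) (l := b) hq (by omega)
  -- The counter advances by `d + 1` here, so the invariant is indexed by the round and not by the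
  -- counter.
  have t₁₀ : Triple μ B _ (Reduction.repeatUntil R (Reduction.putDiagonal R)) _ _ :=
    Triple.loop (μ := μ) (B := B) (b := .wlt (R + 3) (R + 4)) (q * d)
    (fun j s => Loaded R n d (cleared (m + m) w) (upto (b + j * (d + 1)) G) (b + j * (d + 1))
      (b + q * d * (d + 1)) s ∧ s.wreg (R + 6) = d + 1)
    (fun j hj s hs => by
      simp only [Test.holds, hs.1.2.2.2.2.2.2.2.1, hs.1.2.2.2.2.2.2.2.2.1]
      have : j * (d + 1) < q * d * (d + 1) := Nat.mul_lt_mul_of_pos_right hj (by omega)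
      omega)
    (fun s hs => by
      simp only [Test.holds, hs.1.2.2.2.2.2.2.2.1, hs.1.2.2.2.2.2.2.2.2.1]
      omega)
    (fun j hj => by
      have : (j + 1) * (d + 1) ≤ q * d * (d + 1) := Nat.mul_le_mul_right _ hj
      rw [add_mul, one_mul] at this
      simpa only [add_mul, one_mul, add_assoc] using putDiagonal_triple (μ := μ) (R := R)
        (n := n) (wm := cleared (m + m) w) (l := b + q * d * (d + 1)) (by omega) (by omega)
        (hG₅ j hj) (hG₆ j hj))
  have t₁₁ := header_triple (μ := μ) (R := R) (n := n) (d := d) (w := cleared (m + m) w)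
    (dm := G) (i := b + q * d * (d + 1)) (l := b + q * d * (d + 1)) (show 5 ≤ B by omega) hq
    (by omega)
    (fun x hx => by
      simp only [cleared]
      split_ifs with h
      · rfl
      · simpa [Nat.add_sub_cancel' hx] using hw' (x - 2) (by omega)) hH₀ hH₁ hH₂ hH₃ hH₄
  have t₁₂ := Triple.count (μ := μ) (B := B) (Nat.le_add_right 5 n)
    (fun i => Loaded R n d (upto i H) G i (5 + n)) (Loaded.hreg (dm := fun _ => G))
    (fun i hi hi' => putName_triple (by omega) (by omega) (by
      simpa [Nat.add_sub_cancel' hi] using hH₅ (i - 5) (by omega)))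
  have t₁₃ := addLength_triple (μ := μ) (R := R) (n := n) (d := d) (show 1 ≤ B by omega)
    (wm := upto (5 + n) H) (dm := G) (i := 5 + n) (l := 5 + n) (by omega)
  have t₁₄ := Triple.count (μ := μ) (B := B) (Nat.le_add_right (5 + n) n)
    (fun i => Loaded R n d (upto i H) G i (5 + n + n)) (Loaded.hreg (dm := fun _ => G))
    (fun i hi hi' => putLast_triple (by omega) (by omega) (by
      simpa [Nat.add_sub_cancel' hi] using hH₆ (i - (5 + n)) (by omega)))
  rw [upto_eq_self hH₇] at t₁₄
  rw [upto_eq_self hG₇] at t₁₀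
  simp only [zero_mul, add_zero] at t₁₀
  have t₁₀' := t₁₀.mono (fun _ h => h) le_rfl (fun _ h => h.1)
  exact (t₁.seq <| t₂.seq <| t₃.seq <| t₄.seq <| t₅.seq <| t₆.seq <| t₇.seq <| t₈.seq <|
    t₉.seq <| t₁₀'.seq <| t₁₁.seq <| t₁₂.seq <| t₁₃.seq t₁₄).mono (fun _ h => h) (by omega)
    (fun _ h => h)

end

/-! ## Reading off the answer -/

namespace Reduction

def startScan (R : ℕ) : List Instr :=
  [.wconst (R + 5) 0, .wop .add (R + 3) R (R + 5), .wop .add (R + 4) R R, .wconst (R + 6) 0,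
    .dcast (R + 2) (R + 5)]

def advance (R : ℕ) : List Instr := [.wop .add (R + 3) (R + 3) (R + 2)]

/-- Sets word register 0 to 1 if one of the `n` data cells from number `n` on is zero, else to 0. -/
def scan (R : ℕ) : Prog :=
  .seq (.block (startScan R)) <| .seq
    (.loop (.wlt (R + 3) (R + 4))
      (.seq (.block [.dload (R + 1) (R + 3)])
        (.seq (.ite (.deq (R + 1) (R + 2)) (.block [.wconst (R + 6) 1]) (.block []))
          (.block (advance R)))))
    -- Adding the zero in register `R + 5` serves as a move.
    (.block [.wop .add 0 (R + 6) (R + 5)])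

end Reduction

open Classical in
def Scanned (R n : ℕ) (dm : ℕ → ℝ) (i l : ℕ) (s : State) : Prop :=
  s.wreg (R + 2) = 1 ∧ s.wreg (R + 3) = i ∧ s.wreg (R + 4) = l ∧ s.wreg (R + 5) = 0 ∧
    s.wreg (R + 6) = (if ∃ t, n ≤ t ∧ t < i ∧ dm t = 0 then 1 else 0) ∧
    s.dreg (R + 2) = 0 ∧ s.dmem = dm

open Classical in
theorem scan_triple {μ : Arith} {B R n : ℕ} {dm : ℕ → ℝ} (hB : n + n + 2 ≤ B) :
    Triple μ B (fun s => s.wreg R = n ∧ s.wreg (R + 2) = 1 ∧ s.dmem = dm)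
      (Reduction.scan R) (5 * n + 10)
      (fun s => s.wreg 0 = if ∃ t, n ≤ t ∧ t < n + n ∧ dm t = 0 then 1 else 0) := by
  have t₁ : Triple μ B (fun s => s.wreg R = n ∧ s.wreg (R + 2) = 1 ∧ s.dmem = dm)
      (.block (Reduction.startScan R)) 5 (Scanned R n dm n (n + n)) := by
    refine Triple.block (by omega) _ fun s hs ⟨h₁, h₂, h₃⟩ => ?_
    have : ¬ ∃ t, n ≤ t ∧ t < n ∧ dm t = 0 := fun ⟨t, ht, ht', _⟩ => by omega
    simp [Reduction.startScan, Instr.OkThen, Instr.Ok, Instr.apply, WordOp.eval, Scanned,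
      -not_exists, *]
    omega
  have step : ∀ i, n ≤ i → i < n + n → Triple μ B (Scanned R n dm i (n + n))
      (.seq (.block [.dload (R + 1) (R + 3)])
        (.seq (.ite (.deq (R + 1) (R + 2)) (.block [.wconst (R + 6) 1]) (.block []))
          (.block (Reduction.advance R)))) 4 (Scanned R n dm (i + 1) (n + n)) := by
    intro i hi hi'
    have s₁ : Triple μ B (Scanned R n dm i (n + n)) (.block [.dload (R + 1) (R + 3)]) 1
        (fun s => Scanned R n dm i (n + n) s ∧ s.dreg (R + 1) = dm i) := by
      refine Triple.block (by omega) _ fun s hs ⟨h₁, h₂, h₃, h₄, h₅, h₆, h₇⟩ => ?_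
      simp [Instr.OkThen, Instr.Ok, Instr.apply, Scanned, *]
    -- The flag already accounts for cell `i` while the counter still is `i`; the assertion
    -- therefore speaks of the state with the counter advanced.
    have s₂ : Triple μ B (fun s => Scanned R n dm i (n + n) s ∧ s.dreg (R + 1) = dm i)
        (.ite (.deq (R + 1) (R + 2)) (.block [.wconst (R + 6) 1]) (.block [])) 2
        (fun s => Scanned R n dm (i + 1) (n + n) (s := { s with
          wreg := Function.update s.wreg (R + 3) (i + 1) }) ∧ s.wreg (R + 3) = i ∧
          s.wreg (R + 2) = 1) := by
      refine Triple.ite (T := 1) ?_ ((?_ : Triple μ B _ _ 0 _).mono (fun _ h => h) (by omega)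
        (fun _ h => h))
      · refine Triple.block (by omega) _
          fun s hs ⟨⟨⟨h₁, h₂, h₃, h₄, h₅, h₆, h₇⟩, h₈⟩, h₉⟩ => ?_
        simp only [Test.holds, h₆, h₈] at h₉
        have : ∃ t, n ≤ t ∧ t < i + 1 ∧ dm t = 0 := ⟨i, hi, by omega, h₉⟩
        simp [Instr.OkThen, Instr.Ok, Instr.apply, Scanned, h₁, h₂, h₃, h₄, h₆, h₇, this,
          -Order.lt_add_one_iff]
        omega
      · refine Triple.block (by omega) _
          fun s hs ⟨⟨⟨h₁, h₂, h₃, h₄, h₅, h₆, h₇⟩, h₈⟩, h₉⟩ => ?_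
        simp only [Test.holds, h₆, h₈] at h₉
        have : (∃ t, n ≤ t ∧ t < i + 1 ∧ dm t = 0) ↔ ∃ t, n ≤ t ∧ t < i ∧ dm t = 0 := by
          refine exists_congr fun t => ⟨fun ⟨a, b, c⟩ => ⟨a, ?_, c⟩, fun ⟨a, b, c⟩ =>
            ⟨a, by omega, c⟩⟩
          rcases eq_or_ne t i with rfl | h
          · exact absurd c h₉
          · omega
        simp [Instr.OkThen, Scanned, -Order.lt_add_one_iff, *]
    have s₃ : Triple μ B (fun s => Scanned R n dm (i + 1) (n + n) (s := { s with
          wreg := Function.update s.wreg (R + 3) (i + 1) }) ∧ s.wreg (R + 3) = i ∧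
          s.wreg (R + 2) = 1)
        (.block (Reduction.advance R)) 1 (Scanned R n dm (i + 1) (n + n)) := by
      refine Triple.block (by omega) _ fun s hs ⟨h, h₂, h₃⟩ => ?_
      simp only [Reduction.advance, Instr.OkThen, Instr.Ok, Instr.apply, WordOp.eval, h₂, h₃]
      exact ⟨by omega, h⟩
    exact s₁.seq (s₂.seq s₃)
  have t₂ := Triple.count (μ := μ) (B := B) (x := R + 3) (y := R + 4) (Nat.le_add_right n n)
    (fun i => Scanned R n dm i (n + n)) (fun i s hs => ⟨hs.2.1, hs.2.2.1⟩) step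
  have t₃ : Triple μ B (Scanned R n dm (n + n) (n + n)) (.block [.wop .add 0 (R + 6) (R + 5)]) 1
      (fun s => s.wreg 0 = if ∃ t, n ≤ t ∧ t < n + n ∧ dm t = 0 then 1 else 0) := by
    refine Triple.block (by omega) _ fun s hs ⟨h₁, h₂, h₃, h₄, h₅, h₆, h₇⟩ => ?_
    simp only [Instr.OkThen, Instr.Ok, Instr.apply, WordOp.eval, h₄, h₅, Function.update_self]
    refine ⟨?_, by simp⟩
    split_ifs <;> omega
  exact (t₁.seq <| t₂.seq t₃).mono (fun _ h => h) (by omega) (fun _ h => h)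

/-! ## Contents of the memories -/

theorem getD_rowMajor {α : Type*} {k l : ℕ} (M : Fin k → Fin l → α) (a : Fin k) (b : Fin l)
    (z : α) : (rowMajor M).getD (a * l + b) z = M a b := by
  have hlt : (a : ℕ) * l + b < k * l := by
    have : ((a : ℕ) + 1) * l ≤ k * l := Nat.mul_le_mul_right _ a.2
    rw [add_mul, one_mul] at this
    have := b.2
    omega
  have hl : 0 < l := (Nat.zero_le _).trans_lt b.2
  rw [List.getD_eq_getElem _ _ (by simpa [rowMajor] using hlt)]
  simp only [rowMajor, List.getElem_ofFn]
  congr 1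
  · ext
    change ((a : ℕ) * l + b) / l = a
    rw [add_comm, Nat.add_mul_div_right _ _ hl, Nat.div_eq_of_lt b.2, zero_add]
  · ext
    simp [Fin.modNat, Nat.mod_eq_of_lt b.2]

theorem length_rowMajor {α : Type*} {k l : ℕ} (M : Fin k → Fin l → α) :
    (rowMajor M).length = k * l := by simp [rowMajor]

theorem mem_rowMajor {α : Type*} {k l : ℕ} {M : Fin k → Fin l → α} {y : α}
    (h : y ∈ rowMajor M) : ∃ a b, M a b = y := by
  obtain ⟨x, hx⟩ := List.mem_ofFn.1 h
  exact ⟨_, _, hx⟩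

theorem exists_eq_mul_add {n d i : ℕ} (h : i < n * d) :
    ∃ (a : Fin n) (b : Fin d), i = a * d + b := by
  have hd : 0 < d := Nat.pos_of_ne_zero (by rintro rfl; simp at h)
  exact ⟨⟨i / d, Nat.div_lt_of_lt_mul (by rwa [mul_comm])⟩, ⟨i % d, Nat.mod_lt _ hd⟩,
    (Nat.div_add_mod' i d).symm⟩

theorem getD_append_add {α : Type*} (l l' : List α) (x : ℕ) (z : α) :
    (l ++ l').getD (l.length + x) z = l'.getD x z := by
  rw [List.getD_append_right _ _ _ _ (Nat.le_add_right _ _), Nat.add_sub_cancel_left]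

theorem getD_ofFn {α : Type*} {n : ℕ} (f : Fin n → α) (t : Fin n) (z : α) :
    (List.ofFn f).getD t z = f t := by
  rw [List.getD_eq_getElem _ _ (by simp)]
  simp

theorem getD_induction {α : Type*} {p : α → Prop} {l : List α} {z : α} (hl : ∀ y ∈ l, p y)
    (hz : p z) (x : ℕ) : p (l.getD x z) := by
  by_cases hx : x < l.length
  · rw [List.getD_eq_getElem _ _ hx]
    exact hl _ (List.getElem_mem hx)
  · rwa [List.getD_eq_default _ _ (by omega)]

/-- The description `F d` has `q * d` weight vectors, which form an identity matrix, and
describes coordinatewise dominance. -/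
structure Reduction.Describes (q : ℕ) (F : ∀ d, FDesc d) : Prop where
  le_one : q ≤ 1
  words_eq : ∀ d, (F d).words = [1 - q, q * d]
  data_diag : ∀ d, ∀ j < q * d, (F d).data.getD (j * (d + 1)) 0 = 1
  data_off : ∀ d, ∀ j < q * d, ∀ r < d, (F d).data.getD (j * (d + 1) + r + 1) 0 = 0
  data_tail : ∀ d x, q * d * (d + 1) ≤ x → (F d).data.getD x 0 = 0
  data_mem : ∀ d, ∀ y ∈ (F d).data, y = 0 ∨ y = 1
  fdominates_iff : ∀ d (x y : Point d), FDominates (F d).toSet x y ↔ x ≠ y ∧ ∀ i, x i ≤ y i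

theorem describes_projections : Reduction.Describes 1 FDesc.projections where
  le_one := le_rfl
  words_eq d := by simp [FDesc.projections, FDesc.words]
  data_diag d j hj := by
    rw [one_mul] at hj
    have := getD_rowMajor (fun j i : Fin d => (((if i = j then 1 else 0 : ℝ≥0)) : ℝ)) ⟨j, hj⟩
      ⟨j, hj⟩ 0
    simp only [FDesc.projections, FDesc.data, mul_add, mul_one]
    simpa using this
  data_off d j hj r hr := by
    rw [one_mul] at hj
    have key := getD_rowMajor (fun j i : Fin d => (((if i = j then 1 else 0 : ℝ≥0)) : ℝ))
    simp only [FDesc.projections, FDesc.data]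
    -- The position is `j * d + (j + r + 1)`. Either it lies in row `j`, right of the diagonal, or
    -- it wraps around to row `j + 1`, left of the diagonal because `r < d`, or there is no further
    -- row and it is past the end.
    by_cases h₁ : j + r + 1 < d
    · have := key ⟨j, hj⟩ ⟨j + r + 1, h₁⟩ 0
      rw [show j * (d + 1) + r + 1 = j * d + (j + r + 1) by ring]
      rw [this, if_neg (by simp only [Fin.mk.injEq]; omega)]
      rfl
    by_cases h₂ : j + 1 < d
    · have := key ⟨j + 1, h₂⟩ ⟨j + r + 1 - d, by omega⟩ 0
      rw [show j * (d + 1) + r + 1 = (j + 1) * d + (j + r + 1 - d) by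
        rw [mul_add, add_mul]; omega]
      rw [this, if_neg (by simp only [Fin.mk.injEq]; omega)]
      rfl
    · rw [List.getD_eq_default _ _ ?_]
      obtain rfl : d = j + 1 := by omega
      rw [length_rowMajor]
      rw [show (j + 1) * (j + 1) = j * (j + 1 + 1) + 1 by ring]
      omega
  data_tail d x hx := by
    refine List.getD_eq_default _ _ ?_
    rw [FDesc.projections, FDesc.data, length_rowMajor]
    rw [one_mul, mul_add] at hx
    omega
  data_mem d y hy := by
    obtain ⟨a, b, rfl⟩ := mem_rowMajor (M := fun j i : Fin d =>
      (((if i = j then 1 else 0 : ℝ≥0)) : ℝ)) hy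
    split_ifs <;> simp
  fdominates_iff _ := fdominates_projections

theorem describes_allLinear : Reduction.Describes 0 FDesc.allLinear where
  le_one := Nat.zero_le _
  words_eq d := by simp [FDesc.allLinear, FDesc.words]
  data_diag d j hj := by simp at hj
  data_off d j hj := by simp at hj
  data_tail d x _ := by simp [FDesc.allLinear, FDesc.data, rowMajor]
  data_mem d y hy := by simp [FDesc.allLinear, FDesc.data, rowMajor] at hy
  fdominates_iff _ := fdominates_allLinear

/-! ### Cells of the two input memories -/

section
variable {n d : ℕ}

theorem ovInput_wmem_first (A B : Fin n → Fin d → Bool) (a : Fin n) (i : Fin d) :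
    (ovInput A B).wmem (2 + (a * d + i)) = (A a i).toNat := by
  have h := getD_rowMajor (fun a i => (A a i).toNat) a i 0
  have hlt : (a : ℕ) * d + i < n * d := by
    have : ((a : ℕ) + 1) * d ≤ n * d := Nat.mul_le_mul_right _ a.2
    rw [add_mul, one_mul] at this
    have := i.2
    omega
  simp only [ovInput, State.init, List.append_assoc]
  refine (getD_append_add [n, d] _ _ _).trans ?_
  rw [List.getD_append _ _ _ _ (by rwa [length_rowMajor]), h]

theorem ovInput_wmem_second (A B : Fin n → Fin d → Bool) (b : Fin n) (i : Fin d) :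
    (ovInput A B).wmem (2 + (n * d + (b * d + i))) = (B b i).toNat := by
  have h := getD_rowMajor (fun b i => (B b i).toNat) b i 0
  simp only [ovInput, State.init, List.append_assoc]
  refine (getD_append_add [n, d] _ _ _).trans ?_
  have := getD_append_add (rowMajor fun a i => (A a i).toNat) (rowMajor fun b i => (B b i).toNat)
    (b * d + i) 0
  rw [length_rowMajor] at this
  rw [this, h]

theorem ovInput_wmem_le (A B : Fin n → Fin d → Bool) (x : ℕ) :
    (ovInput A B).wmem (2 + x) ≤ 1 := by
  simp only [ovInput, State.init, List.append_assoc]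
  refine (getD_append_add [n, d] _ _ _).le.trans ?_
  refine getD_induction (p := (· ≤ 1)) (fun y hy => ?_) zero_le_one x
  rcases List.mem_append.1 hy with hy | hy <;> obtain ⟨a, i, rfl⟩ := mem_rowMajor hy <;>
    exact Bool.toNat_le _

theorem ovInput_wmem_tail (A B : Fin n → Fin d → Bool) {x : ℕ} (hx : n * d + n * d ≤ x) :
    (ovInput A B).wmem (2 + x) = 0 := by
  refine List.getD_eq_default _ _ ?_
  simp only [List.length_append, length_rowMajor, List.length_cons, List.length_nil]
  omega

theorem ovInput_fits {μ : Arith} {M : ℕ} (A B : Fin n → Fin d → Bool) (hn : n ≤ M) (hd : d ≤ M)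
    (hM : 1 ≤ M) : (ovInput A B).Fits μ M := by
  have h0 : FitsData μ M 0 := by simpa using FitsData.natCast (μ := μ) (Nat.zero_le M) hM
  refine ⟨fun _ => Nat.zero_le _, fun x => ?_, fun _ => h0, fun x => ?_⟩
  · rcases x with _ | _ | x
    · exact hn
    · exact hd
    · rw [show x + 1 + 1 = 2 + x by ring]
      exact (ovInput_wmem_le A B x).trans hM
  · simpa [ovInput, State.init] using h0

variable (hn : 0 < n) (hd : 0 < d) {A B : Fin n → Fin d → Bool} (hA : A.Injective)
  (hB : B.Injective)

theorem arspInput_fits {μ : Arith} {q M : ℕ} {F : ∀ d, FDesc d} (hF : Reduction.Describes q F)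
    (hnM : n + n ≤ M) (hdM : d ≤ M) (hM : 3 ≤ M) :
    (arspInput (ovDataset hn hd hA hB) (F d)).Fits μ M := by
  have h0 : FitsData μ M 0 := by
    simpa using FitsData.natCast (μ := μ) (Nat.zero_le M) (by omega)
  have h1 : FitsData μ M 1 := by
    simpa using FitsData.natCast (μ := μ) (show 1 ≤ M by omega) (by omega)
  have h2 : FitsData μ M 2 := by
    simpa using FitsData.natCast (μ := μ) (show 2 ≤ M by omega) (by omega)
  have h3 : FitsData μ M 3 := by
    simpa using FitsData.natCast (μ := μ) (show 3 ≤ M by omega) (by omega)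
  have hq := hF.le_one
  refine ⟨fun _ => Nat.zero_le _, fun x => ?_, fun _ => h0, fun x => ?_⟩
  · refine getD_induction (p := (· ≤ M)) (fun y hy => ?_) (Nat.zero_le _) x
    have hqd : q * d ≤ M := by interval_cases q <;> simp [hdM]
    simp only [hF.words_eq, List.mem_append, List.mem_cons, List.not_mem_nil, or_false,
      List.mem_ofFn] at hy
    rcases hy with ((rfl | rfl | rfl) | rfl | rfl) | ⟨t, rfl⟩
    all_goals omega
  · refine getD_induction (p := FitsData μ M) (fun y hy => ?_) h0 x
    rcases List.mem_append.1 hy with hy | hy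
    · rcases List.mem_append.1 hy with hy | hy
      · obtain ⟨t, i, rfl⟩ := mem_rowMajor hy
        change FitsData μ M (ovPoint A B t i)
        induction t using Fin.addCases with
        | left a =>
          simp only [ovPoint, Fin.append_left]
          split_ifs <;> simpa
        | right b =>
          simp only [ovPoint, Fin.append_right]
          split_ifs <;> simpa
      · obtain ⟨t, rfl⟩ := List.mem_ofFn.1 hy
        change FitsData μ M (ovProb t)
        induction t using Fin.addCases with
        | left a => rwa [ovProb_castAdd]
        | right b =>
          rw [ovProb_natAdd]
          simpa using FitsData.natCast_div (μ := μ) (k := 1) (l := n) (show 1 ≤ M by omega)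
            (by omega) (by omega)
    · rcases hF.data_mem d y hy with rfl | rfl
      exacts [h0, h1]

theorem arspInput_dmem_point (F : FDesc d) (t : Fin (n + n)) (i : Fin d) :
    (arspInput (ovDataset hn hd hA hB) F).dmem (t * d + i) = ovPoint A B t i := by
  have hlt : (t : ℕ) * d + i < (n + n) * d := by
    have : ((t : ℕ) + 1) * d ≤ (n + n) * d := Nat.mul_le_mul_right _ t.2
    rw [add_mul, one_mul] at this
    have := i.2
    omega
  simp only [arspInput, State.init, List.append_assoc]
  rw [List.getD_append _ _ _ _ (by rwa [length_rowMajor]), getD_rowMajor]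
  rfl

theorem arspInput_dmem_prob (F : FDesc d) (t : Fin (n + n)) :
    (arspInput (ovDataset hn hd hA hB) F).dmem (n * d + n * d + t) = ovProb t := by
  simp only [arspInput, State.init, List.append_assoc]
  have := getD_append_add (rowMajor fun t i => ((ovDataset hn hd hA hB).point t i : ℝ))
    (List.ofFn (ovDataset hn hd hA hB).prob ++ F.data) t 0
  rw [length_rowMajor, add_mul] at this
  rw [this, List.getD_append _ _ _ _ (by simp), getD_ofFn]
  rfl

theorem arspInput_dmem_data (F : FDesc d) (x : ℕ) :
    (arspInput (ovDataset hn hd hA hB) F).dmem (n * d + n * d + n + n + x) =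
      F.data.getD x 0 := by
  simp only [arspInput, State.init]
  have := getD_append_add ((rowMajor fun t i => ((ovDataset hn hd hA hB).point t i : ℝ)) ++
    List.ofFn (ovDataset hn hd hA hB).prob) F.data x 0
  rw [List.length_append, length_rowMajor, add_mul, List.length_ofFn, ← add_assoc] at this
  exact this

theorem arspInput_wmem_obj {q : ℕ} {F : ∀ d, FDesc d} (hF : Reduction.Describes q F)
    (t : Fin (n + n)) :
    (arspInput (ovDataset hn hd hA hB) (F d)).wmem (5 + t) = ovObj t := by
  simp only [arspInput, State.init, hF.words_eq]
  refine (getD_append_add ([n + n, n + 1, d] ++ [1 - q, q * d]) _ _ _).trans ?_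
  rw [getD_ofFn]
  rfl

theorem load_arspInput {μ : Arith} {M R q : ℕ} {F : ∀ d, FDesc d}
    (hF : Reduction.Describes q F) (hM : n * d + n * d + n + n + d * (d + 1) + 10 ≤ M) :
    Triple μ M (fun s => s.wreg = 0 ∧ s.dreg = 0 ∧ s.wmem = (ovInput A B).wmem ∧ s.dmem = 0)
      (Reduction.load R q) (22 * (n * d) + 14 * n + 3 * d + 40)
      (Loaded R n d (arspInput (ovDataset hn hd hA hB) (F d)).wmem
        (arspInput (ovDataset hn hd hA hB) (F d)).dmem (5 + n + n) (5 + n + n)) := by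
  refine load_triple hF.le_one hM rfl rfl (ovInput_wmem_le A B)
    (fun x hx => ovInput_wmem_tail A B hx) ?_ ?_ ?_ ?_ ?_ ?_ ?_ rfl rfl rfl ?_ ?_ ?_ ?_ ?_
  · intro i hi
    obtain ⟨a, j, rfl⟩ := exists_eq_mul_add hi
    rw [ovInput_wmem_first]
    refine (arspInput_dmem_point hn hd hA hB (F d) (Fin.castAdd n a) j).trans ?_
    simp only [ovPoint, Fin.append_left]
    cases A a j <;> norm_num
  · intro i hi
    obtain ⟨b, j, rfl⟩ := exists_eq_mul_add hi
    -- Vector `b` is instance `n + b`, so its row starts at `(n + b) * d`, the same offset as in the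
    -- source.
    rw [ovInput_wmem_second, ← add_assoc, ← add_mul]
    refine (arspInput_dmem_point hn hd hA hB (F d) (Fin.natAdd n b) j).trans ?_
    simp only [ovPoint, Fin.append_right]
    cases B b j <;> norm_num
  · intro i hi
    exact (arspInput_dmem_prob hn hd hA hB (F d) (Fin.castAdd n ⟨i, hi⟩)).trans
      (ovProb_castAdd _)
  · intro i hi
    rw [add_assoc (n * d + n * d)]
    exact (arspInput_dmem_prob hn hd hA hB (F d) (Fin.natAdd n ⟨i, hi⟩)).trans
      (ovProb_natAdd _)
  · intro j hj
    rw [arspInput_dmem_data, hF.data_diag d j hj]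
  · intro j hj r hr
    rw [add_assoc, add_assoc _ _ (r + 1), ← add_assoc _ r 1, arspInput_dmem_data,
      hF.data_off d j hj r hr]
  · intro x hx
    obtain ⟨y, rfl⟩ := Nat.exists_eq_add_of_le (show n * d + n * d + n + n ≤ x by omega)
    rw [arspInput_dmem_data, hF.data_tail d y (by omega)]
  · simp [arspInput, State.init, hF.words_eq]
  · simp [arspInput, State.init, hF.words_eq]
  · intro t ht
    exact (arspInput_wmem_obj hn hd hA hB hF (Fin.castAdd n ⟨t, ht⟩)).trans
      (by rw [ovObj_castAdd]; rfl)
  · intro t ht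
    rw [add_assoc]
    exact (arspInput_wmem_obj hn hd hA hB hF (Fin.natAdd n ⟨t, ht⟩)).trans
      (by rw [ovObj_natAdd]; rfl)
  · intro x hx
    refine List.getD_eq_default _ _ ?_
    simp only [hF.words_eq, List.length_append, List.length_ofFn, List.length_cons,
      List.length_nil]
    omega

end

/-! ## The reduction -/

/-- `log n ≤ 2 √n` and `log 2 > 1/2`. -/
theorem logb_two_le_mul_rpow {n : ℕ} (hn : 1 ≤ n) :
    Real.logb 2 n ≤ 4 * (n : ℝ) ^ (1 / 2 : ℝ) := by
  have h₁ := Real.log_le_rpow_div (x := n) (by positivity) (ε := 1 / 2) (by norm_num)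
  have h₂ := Real.log_two_gt_d9
  have h₃ : 0 ≤ (n : ℝ) ^ (1 / 2 : ℝ) := by positivity
  rw [Real.logb, div_le_iff₀ (by linarith)]
  nlinarith

/-- `d ≤ c n ≤ 2 ^ c * n ≤ n ^ (c + 1)`: the dimension fits into a word. -/
theorem le_pow_of_le_mul_logb {n d c : ℕ} (hn : 2 ≤ n) (h : (d : ℝ) ≤ c * Real.logb 2 n) :
    d ≤ n ^ (c + 1) := by
  have h₁ : Real.logb 2 n ≤ n := by
    rw [Real.logb_le_iff_le_rpow (by norm_num) (by positivity), Real.rpow_natCast]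
    exact_mod_cast Nat.lt_two_pow_self.le
  have h₂ : d ≤ c * n := by
    have := h.trans (mul_le_mul_of_nonneg_left h₁ (Nat.cast_nonneg c))
    exact_mod_cast this
  refine h₂.trans ?_
  rw [pow_succ]
  exact Nat.mul_le_mul_right _ (Nat.lt_two_pow_self.le.trans (Nat.pow_le_pow_left hn c))

/-- For `n = 0` and `n = 1` the logarithm is zero, which leaves no dimension `d ≥ 1`. -/
theorem two_le_of_le_mul_logb {n d c : ℕ} (hd : 1 ≤ d) (h : (d : ℝ) ≤ c * Real.logb 2 n) :
    2 ≤ n := by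
  by_contra! hn
  have : (1 : ℝ) ≤ d := by exact_mod_cast hd
  interval_cases n <;> simp at h <;> omega

theorem two_mul_rpow_le {n : ℕ} (hn : 1 ≤ n) {δ δ' : ℝ} (hδ : δ' ≤ δ) (hδ' : 0 ≤ δ') :
    ((n + n : ℕ) : ℝ) ^ (2 - δ) ≤ 4 * (n : ℝ) ^ (2 - δ') := by
  have hn' : (1 : ℝ) ≤ n := by exact_mod_cast hn
  calc ((n + n : ℕ) : ℝ) ^ (2 - δ) = (2 * (n : ℝ)) ^ (2 - δ) := by push_cast; ring_nf
    _ ≤ (2 * (n : ℝ)) ^ (2 - δ') := Real.rpow_le_rpow_of_exponent_le (by linarith) (by linarith)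
    _ = 2 ^ (2 - δ') * (n : ℝ) ^ (2 - δ') := Real.mul_rpow (by norm_num) (by positivity)
    _ ≤ 2 ^ (2 : ℝ) * (n : ℝ) ^ (2 - δ') := by
      gcongr
      · norm_num
      · linarith
    _ = 4 * (n : ℝ) ^ (2 - δ') := by norm_num

/-- Decides orthogonal vectors with the help of a program `P` for skyline probabilities. -/
def Reduction.prog (q : ℕ) (P : Prog) : Prog :=
  .seq (load P.regBound q) (.seq P (scan P.regBound))

theorem exec_reduction {μ : Arith} {q M M' n d τ : ℕ} {F : ∀ d, FDesc d}
    (hF : Reduction.Describes q F) (hn : 0 < n) (hd : 0 < d) {A B : Fin n → Fin d → Bool}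
    (hA : A.Injective) (hB : B.Injective) (P : Prog) {s : State}
    (hM' : n * d + n * d + n + n + d * (d + 1) + 10 ≤ M') (hMM : M ≤ M')
    (hP : Exec μ M P (arspInput (ovDataset hn hd hA hB) (F d)) τ s)
    (hs : ∀ t : Fin (n + n), s.dmem t = (ovDataset hn hd hA hB).rskyProb (F d).toSet t) :
    ∃ t s', Exec μ M' (Reduction.prog q P) (ovInput A B) t s' ∧ t ≤ 94 * (n * d) + τ ∧
      s'.wreg 0 = open Classical in if HasOrthogonalPair A B then 1 else 0 := by
  classical
  set R := P.regBound
  obtain ⟨t₁, s₁, e₁, ht₁, z, z', h₁, -, h₃, -, -, -, -, hw, hdm⟩ :=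
    load_arspInput (μ := μ) (R := R) hn hd hA hB hF hM' (ovInput A B)
      (ovInput_fits A B (by omega) (by nlinarith) (by omega))
      ⟨rfl, rfl, rfl, by ext x; simp [ovInput, State.init]⟩
  have hs₁ := e₁.fits (ovInput_fits A B (by omega) (by nlinarith) (by omega))
  -- After loading, the registers below `R` are zero and the memories are those of the input of `P`.
  -- The state is thus that input overlaid with its own high registers, and the run of `P` transfers
  -- to it.
  have heq : (arspInput (ovDataset hn hd hA hB) (F d)).overlay R s₁ = s₁ := by
    obtain ⟨wr, wm, dr, dm⟩ := s₁
    simp only at z z' hw hdm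
    simp only [State.overlay, hw, hdm, State.mk.injEq, true_and, and_true]
    constructor <;> funext x <;> split_ifs with hx
    exacts [(z x hx).symm, rfl, (z' x hx).symm, rfl]
  have e₂ := hP.overlay hMM hs₁ (R := R) le_rfl
  rw [heq] at e₂
  obtain ⟨t₃, s₃, e₃, ht₃, h⟩ := scan_triple (μ := μ) (B := M') (R := R) (n := n)
    (dm := s.dmem) (by omega) (s.overlay R s₁) (e₂.fits hs₁)
    ⟨by simp [State.overlay, h₁], by simp [State.overlay, h₃], rfl⟩
  refine ⟨_, s₃, e₁.seq (e₂.seq e₃), ?_, ?_⟩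
  -- As `1`, `n` and `d` are at most `n * d`, the total is bounded with `22 + 14 + 3 + 40 + 5 + 10 =
  -- 94`.
  · have h₄ : n ≤ n * d := Nat.le_mul_of_pos_right n hd
    have h₅ : d ≤ n * d := Nat.le_mul_of_pos_left d hn
    omega
  · have hiff : (∃ t, n ≤ t ∧ t < n + n ∧ s.dmem t = 0) ↔ HasOrthogonalPair A B := by
      have hb : ∀ b : Fin n, s.dmem (n + b) = 0 ↔
          ∃ a, ∑ i, (A a i).toNat * (B b i).toNat = 0 := fun b => by
        rw [← rskyProb_natAdd_eq_zero_iff hn hd hA hB (hF.fdominates_iff d), ← hs]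
        rfl
      constructor
      · rintro ⟨t, ht, ht', h0⟩
        obtain ⟨b, rfl⟩ := Nat.exists_eq_add_of_le ht
        obtain ⟨a, ha⟩ := (hb ⟨b, by omega⟩).1 h0
        exact ⟨a, _, ha⟩
      · rintro ⟨a, b, hab⟩
        exact ⟨n + b, by omega, by omega, (hb b).2 ⟨a, hab⟩⟩
    simpa only [hiff] using h

/-- The step from `c` to `c + 1` makes the input bound large enough for the words `2n` and `d` of
the constructed dataset. -/
theorem solvesOV_of_solvesARSP {μ : Arith} {c q : ℕ} {δ : ℝ} {F : ∀ d, FDesc d}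
    (hF : Reduction.Describes q F) (hδ : 0 < δ) {P : Prog}
    (h : SolvesARSP μ (c + 1) δ F P) : ∃ Q, SolvesOV μ c (min δ (1 / 2)) Q := by
  obtain ⟨C, K, h⟩ := h
  -- `376 = 94 * 4` comes from `n d ≤ 4 c n ^ (2 - δ')` with `δ' = min δ (1/2)`, and the other 4
  -- from doubling the number of instances; `C` could be negative. The words of `P` need `(2n) ^ K ≤
  -- n ^ (2K)`, those of the reduction at most `8 n ^ (2c + 2) ≤ n ^ (2c + 5)`.
  refine ⟨Reduction.prog q P, 376 * c + 4 * max C 0, 2 * K + (2 * c + 5), fun n d hd hdc A B hA hB => ?_⟩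
  have hn := two_le_of_le_mul_logb hd hdc
  have hdn := le_pow_of_le_mul_logb hn hdc
  have hn0 : 0 < n := by omega
  have hnN : n ^ (c + 1) ≤ (n + n) ^ (c + 1) := Nat.pow_le_pow_left (by omega) _
  have hN : n + n ≤ (n + n) ^ (c + 1) := Nat.le_self_pow (by omega) _
  have hlog : Real.logb 2 n ≤ Real.logb 2 ((n + n : ℕ) : ℝ) :=
    Real.logb_le_logb_of_le (by norm_num) (by positivity)
      (by push_cast; linarith [n.cast_nonneg (α := ℝ)])
  have hlog0 : 0 ≤ Real.logb 2 n := Real.logb_nonneg (by norm_num) (by exact_mod_cast hn0)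
  obtain ⟨τ, s, hP, hτ, hs⟩ := h (n + n) (n + 1) d hd
    (by
      push_cast at hlog ⊢
      have : (c : ℝ) * Real.logb 2 n ≤ (c + 1) * Real.logb 2 (n + n) := by gcongr; linarith
      linarith)
    (ovDataset hn0 hd hA hB)
    (arspInput_fits hn0 hd hA hB hF hN (hdn.trans hnN) (by omega))
    (fitsData_rskyProb_ovDataset hn0 hd hA hB (by omega) _)
  have hKK : (n + n) ^ K ≤ n ^ (2 * K + (2 * c + 5)) := by
    calc (n + n) ^ K ≤ (n ^ 2) ^ K := Nat.pow_le_pow_left (by nlinarith) _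
      _ = n ^ (2 * K) := (pow_mul ..).symm
      _ ≤ _ := Nat.pow_le_pow_right hn0 (by omega)
  have hM : n * d + n * d + n + n + d * (d + 1) + 10 ≤ n ^ (2 * K + (2 * c + 5)) := by
    have h₁ : n ≤ n ^ (c + 1) := Nat.le_self_pow (by omega) _
    calc n * d + n * d + n + n + d * (d + 1) + 10 ≤ 8 * (n ^ (c + 1) * n ^ (c + 1)) := by
          generalize n ^ (c + 1) = D at *
          nlinarith [Nat.mul_le_mul h₁ hdn, Nat.mul_le_mul hdn hdn]
      _ ≤ n ^ 3 * (n ^ (c + 1) * n ^ (c + 1)) :=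
          Nat.mul_le_mul_right _ (Nat.pow_le_pow_left hn 3)
      _ = n ^ (2 * c + 5) := by ring
      _ ≤ _ := Nat.pow_le_pow_right hn0 (by omega)
  obtain ⟨t, s', he, ht, hs'⟩ := exec_reduction hF hn0 hd hA hB P hM hKK hP hs
  refine ⟨t, s', he, ?_, hs'⟩
  have hn1 : (1 : ℝ) ≤ n := by exact_mod_cast hn0
  have hnd : (n : ℝ) * d ≤ 4 * c * (n : ℝ) ^ (2 - min δ (1 / 2)) := by
    calc (n : ℝ) * d ≤ n * (c * (4 * (n : ℝ) ^ (1 / 2 : ℝ))) := by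
          gcongr
          exact hdc.trans (by gcongr; exact logb_two_le_mul_rpow hn0)
      _ = 4 * c * ((n : ℝ) ^ (1 : ℝ) * (n : ℝ) ^ (1 / 2 : ℝ)) := by rw [Real.rpow_one]; ring
      _ = 4 * c * (n : ℝ) ^ (1 + 1 / 2 : ℝ) := by rw [Real.rpow_add (by positivity)]
      _ ≤ _ := by
          gcongr
          linarith [min_le_right δ (1 / 2)]
  have hτ' : (τ : ℝ) ≤ max C 0 * (4 * (n : ℝ) ^ (2 - min δ (1 / 2))) := by
    refine hτ.trans ((mul_le_mul_of_nonneg_right (le_max_left C 0) (by positivity)).trans ?_)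
    exact mul_le_mul_of_nonneg_left
      (two_mul_rpow_le hn0 (min_le_left _ _) (le_min hδ.le (by norm_num))) (le_max_right C 0)
  have ht' : (t : ℝ) ≤ 94 * (n * d) + τ := by exact_mod_cast ht
  linarith

theorem theorem1 (μ : Arith) (hOV : OVConjecture μ) (δ : ℝ) (hδ : 0 < δ) :
    ∃ c : ℕ, 1 ≤ c ∧
      (¬ ∃ P : Prog, SolvesARSP μ c δ FDesc.projections P) ∧
      (¬ ∃ P : Prog, SolvesARSP μ c δ FDesc.allLinear P) := by
  obtain ⟨c, -, h⟩ := hOV (min δ (1 / 2)) (lt_min hδ (by norm_num))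
  exact ⟨c + 1, by omega, fun ⟨_, hP⟩ => h (solvesOV_of_solvesARSP describes_projections hδ hP),
    fun ⟨_, hP⟩ => h (solvesOV_of_solvesARSP describes_allLinear hδ hP)⟩

end
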